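/- **Model.** There are $k$ facilities. In facility $i$, $n_i$ units with lifetimes $X_{i1},\dots,X_{in_i}$ are put on a life test. All lifetimes (over all facilities) are independent, and $X_{iu}$ has the inverted exponentiated Pareto distribution $\mathrm{IEP}(\alpha_i,\beta)$, with CDF $$F(t;\alpha_i,\beta)=1-\Big[1-\Big(\frac{t}{1+t}\Big)^{\beta}\Big]^{\alpha_i}\quad(t>0),\qquad F(t;\alpha_i,\beta)=0\quad(t\le 0),$$ where $\alpha_1,\dots,\alpha_k,\beta>0$. Facility $i$ is observed under adaptive progressive Type-II censoring with integers $m_i\ge 1$, $R_{i1},\dots,R_{im_i}\ge 0$, $m_i+\sum_{j=1}^{m_i}R_{ij}=n_i$, and threshold time $\tau_i$: the test runs until the $m_i$-th failure, $\mathcal T_{ij}$ is the time of the $j$-th failure among the units still on test, and at time $\mathcal T_{ij}$ exactly $R_{ij}$ of the surviving units on test are withdrawn if $\mathcal T_{ij}<\tau_i$, and none is withdrawn if $\mathcal T_{ij}\ge \tau_i$ (for $j<m_i$). The units to be withdrawn are selected by priority orders of the units that are random with an arbitrary law and jointly independent of the lifetimes (for instance, uniformly at random among the survivors). **Notation.**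 Let $J_i=\#\{j\le m_i:\mathcal T_{ij}<\tau_i\}$ and, for $1\le j\le m_i$, $$\Gamma_{ij}=n_i-j+1-\sum_{l=1}^{\min\{J_i,j-1\}}R_{il},\qquad \mathcal U_{ij}=-\log\big(1-F(\mathcal T_{ij};\alpha_i,\beta)\big),$$ $$\mathcal V_{i1}=\Gamma_{i1}\mathcal U_{i1},\quad \mathcal V_{ij}=\Gamma_{ij}(\mathcal U_{ij}-\mathcal U_{i,j-1})\ (j\ge 2),\qquad \mathcal W_{ij}=\sum_{l=1}^{j}\mathcal V_{il}.$$ For $1\le j\le m_i-1$ let $\mathcal Q_{ij}=\mathcal W_{ij}/\mathcal W_{im_i}$ and let $r_{ij}=R_{ij}$ if $j\le J_i$ and $r_{ij}=0$ if $j>J_i$. With $\varphi_{ij}=\log\big[1-\big(\tfrac{\mathcal T_{ij}}{1+\mathcal T_{ij}}\big)^{\beta}\big]$ put $$S_{ij}=\sum_{l=1}^{j-1}(r_{il}+1)\varphi_{il}+\Big(n_i-\sum_{l=1}^{j-1}(r_{il}+1)\Big)\varphi_{ij},\qquad \mathcal P_i(\beta)=-2\sum_{j=1}^{m_i-1}\log\frac{S_{ij}}{S_{im_i}},$$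 and let $\mathcal P(\beta)=\sum_{i=1}^k\mathcal P_i(\beta)$ and $\mathcal R_i=2\mathcal W_{im_i}$. By $\chi^2_0$ we mean the point mass at $0$. **Theorem.** 1. Almost surely, for all $i$ and all $1\le j\le m_i$: $\Gamma_{ij}$ is the number of units on test in facility $i$ just before the $j$-th failure, $\mathcal U_{ij}=-\alpha_i\varphi_{ij}$, $\mathcal W_{ij}=-\alpha_iS_{ij}$, and $\mathcal P_i(\beta)=-2\sum_{j=1}^{m_i-1}\log \mathcal Q_{ij}$. 2. The normalized spacings $\mathcal V_{ij}$ ($1\le i\le k$, $1\le j\le m_i$) are independent and each has the standard exponential distribution. 3. $\mathcal P_i(\beta)\sim\chi^2_{2(m_i-1)}$ for every $i$, and $\mathcal P_1(\beta),\dots,\mathcal P_k(\beta)$ are mutually independent. 4. $\mathcal P(\beta)\sim\chi^2_{2\sum_{i=1}^k(m_i-1)}$. 5. For every $i$, $\mathcal R_i\sim\chi^2_{2m_i}$, and $\mathcal R_i$ is independent of the random vector $(\mathcal Q_{i1},\dots,\mathcal Q_{i,m_i-1})$. -/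

import Mathlib

open MeasureTheory ProbabilityTheory

namespace BlockCensoring

/-! ### Distributions -/

/-- CDF of the inverted exponentiated Pareto distribution `IEP(α, β)`:
`F(t) = 1 - (1 - (t / (1 + t)) ^ β) ^ α` for `t > 0`, and `0` for `t ≤ 0`. -/
noncomputable def iepCDF (α β t : ℝ) : ℝ :=
  if 0 < t then 1 - (1 - (t / (1 + t)) ^ β) ^ α else 0

/-- The `χ²` distribution with `d` degrees of freedom: the Gamma distribution with shape `d / 2` and
rate `1 / 2`, and, for `d = 0` (an empty sum of squares), the point mass at `0`. -/
noncomputable def chiSquared (d : ℕ) : Measure ℝ :=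
  if d = 0 then Measure.dirac 0 else gammaMeasure ((d : ℝ) / 2) (1 / 2)

/-! ### The adaptive progressive Type-II censoring experiment in one facility -/

/-- The design of the life test in one facility: the number `n` of units put on test, the number `m`
of failures to be observed, the planned numbers `R 1, …, R m` of withdrawals at the successive
failures (values of `R` outside `1, …, m` play no role) and the threshold time `τ`. -/
structure Plan where
  n : ℕ
  m : ℕ
  R : ℕ → ℕ
  τ : ℝ
  one_le_m : 1 ≤ m
  sum_R : m + ∑ j ∈ Finset.Icc 1 m, R j = n

/-- All subsets of the finite set of priority orders are measurable. -/
instance (n : ℕ) : MeasurableSpace (Equiv.Perm (Fin n)) := ⊤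

/-- The first failure time among the units in `A` (with the convention `0` if `A` is empty). -/
noncomputable def firstFailure {n : ℕ} (x : Fin n → ℝ) (A : Finset (Fin n)) : ℝ :=
  if h : A.Nonempty then A.inf' h x else 0

/-- The units that stay on test when `r` units of `B` are withdrawn: those withdrawn are the first
`r` units of `B` in the priority order `s`. -/
def withdraw {n : ℕ} (s : Equiv.Perm (Fin n)) (r : ℕ) (B : Finset (Fin n)) : Finset (Fin n) :=
  B.filter fun u => r ≤ (B.filter fun v => s v < s u).card

/-- The units that are still on test after the `j`-th failure and the withdrawals made at that
moment, when the units have lifetimes `x` and the units to be withdrawn at the `l`-th failure are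
selected by the priority order `s l`. If the `l`-th failure occurs before the threshold time then
`R l` surviving units are withdrawn; if it occurs later then no unit is withdrawn. -/
noncomputable def onTest (c : Plan) (s : ℕ → Equiv.Perm (Fin c.n)) (x : Fin c.n → ℝ) :
    ℕ → Finset (Fin c.n)
  | 0 => Finset.univ
  | j + 1 =>
    if firstFailure x (onTest c s x j) < c.τ then
      withdraw (s (j + 1)) (c.R (j + 1))
        ((onTest c s x j).filter fun u => firstFailure x (onTest c s x j) < x u)
    else (onTest c s x j).filter fun u => firstFailure x (onTest c s x j) < x u

/-- The `j`-th observed failure time, `j = 1, …, m`. -/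
noncomputable def failureTime (c : Plan) (s : ℕ → Equiv.Perm (Fin c.n)) (x : Fin c.n → ℝ)
    (j : ℕ) : ℝ :=
  firstFailure x (onTest c s x (j - 1))

/-! ### Statistics of the observed failure times `T 1, …, T m` of one facility -/

/-- `J`, the number of observed failures before the threshold time. -/
noncomputable def J (c : Plan) (T : ℕ → ℝ) : ℕ :=
  ((Finset.Icc 1 c.m).filter fun j => T j < c.τ).card

/-- The effective numbers `r j` of withdrawals, `j = 1, …, m`. -/
noncomputable def r (c : Plan) (T : ℕ → ℝ) (j : ℕ) : ℤ :=
  if J c T < c.m - 1 then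
    if j ≤ J c T then c.R j
    else if j ≤ c.m - 1 then 0
    else (c.n : ℤ) - c.m - ∑ l ∈ Finset.Icc 1 (J c T), (c.R l : ℤ)
  else c.R j

/-- `Γ j = n - j + 1 - ∑_{l ≤ min (J, j - 1)} R l`, for `j = 1, …, m`. -/
noncomputable def Γ (c : Plan) (T : ℕ → ℝ) (j : ℕ) : ℤ :=
  (c.n : ℤ) - j + 1 - ∑ l ∈ Finset.Icc 1 (min (J c T) (j - 1)), (c.R l : ℤ)

/-- `U j = -log (1 - F (T j; α, β))`. -/
noncomputable def U (α β : ℝ) (T : ℕ → ℝ) (j : ℕ) : ℝ :=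
  -Real.log (1 - iepCDF α β (T j))

/-- The normalized spacings `V 1 = Γ 1 * U 1` and `V j = Γ j * (U j - U (j - 1))` for `j ≥ 2`. -/
noncomputable def V (c : Plan) (α β : ℝ) (T : ℕ → ℝ) (j : ℕ) : ℝ :=
  (Γ c T j : ℝ) * (U α β T j - if j = 1 then 0 else U α β T (j - 1))

/-- `W j = V 1 + ⋯ + V j`. -/
noncomputable def W (c : Plan) (α β : ℝ) (T : ℕ → ℝ) (j : ℕ) : ℝ :=
  ∑ l ∈ Finset.Icc 1 j, V c α β T l

/-- The ratios `Q j = W j / W m`, `j = 1, …, m - 1`. -/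
noncomputable def Q (c : Plan) (α β : ℝ) (T : ℕ → ℝ) (j : ℕ) : ℝ :=
  W c α β T j / W c α β T c.m

/-- `φ j = log (1 - (T j / (1 + T j)) ^ β)`. -/
noncomputable def φ (β : ℝ) (T : ℕ → ℝ) (j : ℕ) : ℝ :=
  Real.log (1 - (T j / (1 + T j)) ^ β)

/-- `S j = ∑_{l < j} (r l + 1) φ l + (n - ∑_{l < j} (r l + 1)) φ j`. -/
noncomputable def S (c : Plan) (β : ℝ) (T : ℕ → ℝ) (j : ℕ) : ℝ :=
  ∑ l ∈ Finset.Ico 1 j, ((r c T l : ℝ) + 1) * φ β T l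
    + ((c.n : ℝ) - ∑ l ∈ Finset.Ico 1 j, ((r c T l : ℝ) + 1)) * φ β T j

/-- The pivotal quantity `P(β) = -2 ∑_{j=1}^{m-1} log (S j / S m)` of one facility, a function of
`β` and of the observed failure times only. -/
noncomputable def pivot (c : Plan) (β : ℝ) (T : ℕ → ℝ) : ℝ :=
  -2 * ∑ j ∈ Finset.Icc 1 (c.m - 1), Real.log (S c β T j / S c β T c.m)

end BlockCensoring

open BlockCensoring

/-! The cumulative hazard `H = hazard (α i) β`, that is `-log (1 - F)`, is strictly increasing on
the positive axis and carries `IEP(α i, β)` to the standard exponential law. The experiment only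
compares lifetimes with one another and with the threshold. Applying `H` to the lifetimes and to the
threshold therefore leaves the same units on test (`survivors_congr_order`), and almost surely the
`V` are the normalized spacings of an experiment with exponential lifetimes (`V_eq_spacing`).

For exponential lifetimes and fixed priority orders the argument is the memoryless property. If the
units of a set `A` are on test at time `t`, they are conditioned only to outlive `t`. The minimum of
their lifetimes exceeds `t` by an exponential time of rate `A.card`. Once the failing unit and the
failure time `z` are known, the withdrawals are determined, and the units kept on test are again
conditioned only to outlive `z`. The adaptive rule is harmless because it uses only the past.
`lintegral_prod_mul_spacingProd` makes this an induction on the number of failures, with weights `w`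
on the lifetimes in place of conditional laws. As the resulting law is the same for all priority
orders, random orders independent of the lifetimes do not change it (`hasLaw_spacing`), and
independence across facilities is inherited.

The pivots are handled by the ratios of successive partial sums `W j`. For independent exponential
`V`, the variables `j * log (W (j + 1) / W j)`, `1 ≤ j < m`, are again independent exponential and
independent of `W m`. This follows by adding one variable at a time through a two-variable change of
coordinates (`lintegral_gamma_exp_log_ratio`, `lintegral_prod_logRatio`). By summation by parts, `-∑
log (W j / W m)` is the sum of these `m - 1` variables, and twice an Erlang variable is `χ²`. The `Q
j` are functions of the same variables, hence independent of `W m`. Finally `W j = -α * S j`, so `α`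
cancels in the ratios and the pivot depends on `β` alone. -/

/-! ### Integrals against Gamma and exponential laws -/

open Set in
theorem lintegral_gammaMeasure_nat (m : ℕ) (f : ℝ → ENNReal) :
    ∫⁻ x, f x ∂gammaMeasure (m + 1) 1 =
      ∫⁻ x in Ioi 0, ENNReal.ofReal (x ^ m / m.factorial * Real.exp (-x)) * f x := by
  rw [gammaMeasure, lintegral_withDensity_eq_lintegral_mul_non_measurable _
    (f := gammaPDF (m + 1) 1) (measurable_gammaPDFReal _ _).ennreal_ofReal (by simp [gammaPDF]),
    ← lintegral_indicator measurableSet_Ioi]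
  refine lintegral_congr_ae ?_
  filter_upwards [compl_mem_ae_iff.mpr (measure_singleton (0 : ℝ))] with x hx
  rcases lt_or_gt_of_ne hx with h | h
  · simp [indicator, h.not_gt, gammaPDF_of_neg h]
  · simp only [Pi.mul_apply, gammaPDF_of_nonneg h.le, indicator, mem_Ioi, h, if_true]
    congr 2
    rw [Real.Gamma_nat_eq_factorial]
    simp only [Real.one_rpow, add_sub_cancel_right, Real.rpow_natCast, one_mul]
    ring

open Set in
theorem lintegral_expMeasure_one (f : ℝ → ENNReal) :
    ∫⁻ x, f x ∂expMeasure 1 = ∫⁻ x in Ioi 0, ENNReal.ofReal (Real.exp (-x)) * f x := by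
  simpa [expMeasure] using lintegral_gammaMeasure_nat 0 f

instance isProbabilityMeasure_expMeasure_one : IsProbabilityMeasure (expMeasure 1) :=
  isProbabilityMeasure_expMeasure one_pos

instance nullSingletonClass_expMeasure_one : NullSingletonClass (expMeasure 1) := by
  unfold expMeasure gammaMeasure; infer_instance

open Set in
/-- Substitution `x = w * exp (-d / (m + 1))` in an integral over `(0, w)`. -/
theorem lintegral_Ioo_log_ratio (m : ℕ) {w : ℝ} (hw : 0 < w) (g : ℝ → ENNReal) :
    ∫⁻ x in Ioo 0 w, ENNReal.ofReal (x ^ m / m.factorial * Real.exp (-w)) *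
        g ((m + 1) * Real.log (w / x)) =
      ENNReal.ofReal (w ^ (m + 1) / (m + 1).factorial * Real.exp (-w)) *
        ∫⁻ d in Ioi 0, ENNReal.ofReal (Real.exp (-d)) * g d := by
  have hm : (0 : ℝ) < m + 1 := by positivity
  have himg : (fun d : ℝ => w * Real.exp (-d / (m + 1))) '' Ioi 0 = Ioo 0 w := by
    ext x
    constructor
    · rintro ⟨d, hd, rfl⟩
      refine ⟨by positivity, ?_⟩
      have : Real.exp (-d / (m + 1)) < 1 := by
        rw [Real.exp_lt_one_iff]
        exact div_neg_of_neg_of_pos (neg_neg_of_pos hd) hm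
      show w * Real.exp (-d / (m + 1)) < w
      nlinarith
    · rintro ⟨h0, h1⟩
      refine ⟨(m + 1) * Real.log (w / x), ?_, ?_⟩
      · exact mul_pos hm (Real.log_pos ((one_lt_div h0).2 h1))
      · have : -((m + 1) * Real.log (w / x)) / ((m : ℝ) + 1) = Real.log (x / w) := by
          rw [neg_div, mul_div_cancel_left₀ _ hm.ne', ← Real.log_inv, inv_div]
        simp only [this]
        rw [Real.exp_log (by positivity)]
        field_simp
  rw [← himg, lintegral_image_eq_lintegral_deriv_mul_of_antitoneOn measurableSet_Ioi
    (f' := fun d => w * (Real.exp (-d / (m + 1)) * (-1 / (m + 1)))),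
    ← lintegral_const_mul' _ _ (by simp)]
  · refine setLIntegral_congr_fun measurableSet_Ioi fun d hd => ?_
    have h1 : ((m : ℝ) + 1) * Real.log (w / (w * Real.exp (-d / (m + 1)))) = d := by
      rw [div_mul_cancel_left₀ hw.ne', ← Real.exp_neg, Real.log_exp]
      field_simp
    rw [h1, ← mul_assoc, ← ENNReal.ofReal_mul,
      ← mul_assoc (ENNReal.ofReal (w ^ (m + 1) / (m + 1).factorial * Real.exp (-w))),
      ← ENNReal.ofReal_mul (by positivity)]
    · congr 2
      -- The integrand supplies the power `m` of `exp (-d / (m + 1))` and the Jacobian one more; the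
      -- Jacobian's factor `1 / (m + 1)` turns `m!` into `(m + 1)!`.
      have h2 : Real.exp (-d) = Real.exp (-d / (m + 1)) ^ (m + 1) := by
        rw [← Real.exp_nat_mul]
        congr 1
        push_cast
        field_simp
      rw [h2, Nat.factorial_succ]
      push_cast
      field_simp
      ring
    · have := Real.exp_pos (-d / (m + 1))
      have : w * (Real.exp (-d / (m + 1)) * (-1 / (m + 1))) =
        - (w * Real.exp (-d / (m + 1)) / (m + 1)) := by ring
      rw [this, neg_neg]
      positivity
  · intro d hd
    refine HasDerivAt.hasDerivWithinAt ?_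
    refine HasDerivAt.const_mul w (HasDerivAt.exp ?_)
    exact (hasDerivAt_id d).neg.div_const _
  · intro a _ b _ hab
    simp only
    gcongr

open Set in
/-- If `X ∼ Γ(m + 1)` and `Y ∼ Exp` are independent then `(m + 1) log ((X + Y) / X)` and `X + Y`
are independent with laws `Exp` and `Γ(m + 2)`. -/
theorem lintegral_gamma_exp_log_ratio (m : ℕ) {g : ℝ → ℝ → ENNReal}
    (hg : Measurable (Function.uncurry g)) :
    ∫⁻ x, ∫⁻ y, g ((m + 1) * Real.log ((x + y) / x)) (x + y) ∂expMeasure 1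
        ∂gammaMeasure (m + 1) 1 =
      ∫⁻ w, ∫⁻ d, g d w ∂expMeasure 1 ∂gammaMeasure (m + 1 + 1) 1 := by
  have h1 : ((m : ℝ) + 1 + 1) = ((m + 1 : ℕ) : ℝ) + 1 := by push_cast; ring
  rw [lintegral_gammaMeasure_nat, h1, lintegral_gammaMeasure_nat]
  simp_rw [lintegral_expMeasure_one]
  -- Substitution `w = x + y`; afterwards the order of integration over `0 < x < w` is exchanged.
  have h2 : ∀ x : ℝ, ∫⁻ y in Ioi 0, ENNReal.ofReal (Real.exp (-y)) *
      g ((m + 1) * Real.log ((x + y) / x)) (x + y) =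
      ∫⁻ w, (Ioi x).indicator (fun w => ENNReal.ofReal (Real.exp (-(w - x))) *
        g ((m + 1) * Real.log (w / x)) w) w := by
    intro x
    rw [← lintegral_indicator measurableSet_Ioi,
      ← lintegral_sub_right_eq_self (μ := volume) _ x]
    refine lintegral_congr fun w => ?_
    simp only [indicator, mem_Ioi, sub_pos, add_sub_cancel]
  simp_rw [h2]
  rw [← lintegral_indicator measurableSet_Ioi, ← lintegral_indicator measurableSet_Ioi]
  have h3 : ∀ x : ℝ, (Ioi 0).indicator (fun x =>
      ENNReal.ofReal (x ^ m / m.factorial * Real.exp (-x)) *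
      ∫⁻ w, (Ioi x).indicator (fun w => ENNReal.ofReal (Real.exp (-(w - x))) *
        g ((m + 1) * Real.log (w / x)) w) w) x =
      ∫⁻ w, {p : ℝ × ℝ | 0 < p.1 ∧ p.1 < p.2}.indicator (fun p =>
        ENNReal.ofReal (p.1 ^ m / m.factorial * Real.exp (-p.2)) *
        g ((m + 1) * Real.log (p.2 / p.1)) p.2) (x, w) := by
    intro x
    by_cases hx : 0 < x
    · rw [indicator_of_mem (by exact hx), ← lintegral_const_mul' _ _ (by simp)]
      refine lintegral_congr fun w => ?_
      by_cases hw : x < w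
      · simp only [indicator, mem_Ioi, hw, hx, mem_ofPred_eq, and_self, if_true]
        rw [← mul_assoc, ← ENNReal.ofReal_mul (by positivity), mul_assoc, ← Real.exp_add]
        congr 4
        ring
      · simp [indicator, hw]
    · simp [indicator, hx]
  simp_rw [h3]
  have hS : MeasurableSet {p : ℝ × ℝ | 0 < p.1 ∧ p.1 < p.2} :=
    (measurableSet_lt measurable_const measurable_fst).inter
      (measurableSet_lt measurable_fst measurable_snd)
  rw [lintegral_lintegral_swap]
  · refine lintegral_congr fun w => ?_
    by_cases hw : 0 < w
    · rw [indicator_of_mem (by exact hw), ← lintegral_Ioo_log_ratio m hw (fun d => g d w),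
        ← lintegral_indicator measurableSet_Ioo]
      rfl
    · rw [indicator_of_notMem (by exact hw)]
      rw [lintegral_eq_zero_of_ae_eq_zero]
      refine Filter.Eventually.of_forall fun x => ?_
      simp only [indicator, mem_ofPred_eq, Pi.zero_apply, ite_eq_right_iff]
      intro h; exact absurd (h.1.trans h.2) hw
  · refine (Measurable.indicator ?_ hS).aemeasurable
    refine Measurable.mul (by fun_prop) ?_
    exact hg.comp (by fun_prop : Measurable fun p : ℝ × ℝ =>
      (((m : ℝ) + 1) * Real.log (p.2 / p.1), p.2))

open Set in
/-- The first of `a` exponential lifetimes exceeding `t`, normalized. -/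
theorem lintegral_exp_spacing {a : ℕ} (ha : 1 ≤ a) {t : ℝ} (ht : 0 ≤ t) (f : ℝ → ENNReal) :
    a * ∫⁻ z in Ioi t, f (a * (z - t)) * ENNReal.ofReal (Real.exp (-z)) ^ (a - 1) ∂expMeasure 1 =
      ENNReal.ofReal (Real.exp (-t)) ^ a * ∫⁻ y, f y ∂expMeasure 1 := by
  have ha' : (0 : ℝ) < a := by exact_mod_cast ha
  have himg : (fun z : ℝ => a * (z - t)) '' Ioi t = Ioi 0 := by
    ext x
    constructor
    · rintro ⟨z, hz, rfl⟩
      exact mul_pos ha' (sub_pos.2 hz)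
    · intro hx
      exact ⟨t + x / a, by simpa using div_pos hx ha', by field_simp; ring⟩
  have hleft (F : ℝ → ENNReal) : ∫⁻ z in Ioi t, F z ∂expMeasure 1 =
      ∫⁻ z in Ioi t, ENNReal.ofReal (Real.exp (-z)) * F z := by
    rw [← lintegral_indicator measurableSet_Ioi, lintegral_expMeasure_one,
      ← lintegral_indicator measurableSet_Ioi, ← lintegral_indicator measurableSet_Ioi]
    refine lintegral_congr fun z => ?_
    by_cases hz : t < z
    · simp [indicator, hz, ht.trans_lt hz]
    · simp [indicator, hz]
  rw [hleft, lintegral_expMeasure_one, ← himg,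
    lintegral_image_eq_lintegral_deriv_mul_of_monotoneOn measurableSet_Ioi
      (f' := fun _ => (a : ℝ)), ← lintegral_const_mul' _ _ (by finiteness),
      ← lintegral_const_mul' _ _ (by finiteness)]
  · refine setLIntegral_congr_fun measurableSet_Ioi fun z hz => ?_
    · rw [← ENNReal.ofReal_natCast a]
      have : ENNReal.ofReal (Real.exp (-t)) ^ a * (ENNReal.ofReal a *
          (ENNReal.ofReal (Real.exp (-(a * (z - t)))) * f (a * (z - t)))) =
          (ENNReal.ofReal a * f (a * (z - t))) * (ENNReal.ofReal (Real.exp (-t)) ^ a *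
          ENNReal.ofReal (Real.exp (-(a * (z - t))))) := by ring
      rw [this, ← ENNReal.ofReal_pow (by positivity), ← ENNReal.ofReal_pow (by positivity),
        ← ENNReal.ofReal_mul (by positivity), ← Real.exp_nat_mul, ← Real.exp_nat_mul,
        ← Real.exp_add]
      -- Both exponents equal `-a * z`: one factor `exp (-z)` is the density of the failing unit,
      -- the other `a - 1` are the survival probabilities of the rest.
      have h2 : (a : ℝ) * -t + -(a * (z - t)) = -z + ((a - 1 : ℕ) : ℝ) * -z := by
        rw [Nat.cast_sub ha]; push_cast; ring
      rw [h2, Real.exp_add, ENNReal.ofReal_mul (by positivity)]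
      ring
  · intro z _
    have := ((hasDerivAt_id z).sub_const t).const_mul (a : ℝ)
    simpa using this.hasDerivWithinAt
  · intro x _ y _ hxy
    simp only
    gcongr

open Set in
theorem expMeasure_one_Ioi {t : ℝ} (ht : 0 ≤ t) :
    expMeasure 1 (Ioi t) = ENNReal.ofReal (Real.exp (-t)) := by
  have := lintegral_exp_spacing (le_refl 1) ht (fun _ => 1)
  simpa using this

/-! ### Erlang laws and their relation to `χ²` -/

/-- The law of a sum of `d` independent standard exponential variables. -/
noncomputable def erlang (d : ℕ) : Measure ℝ :=
  if d = 0 then Measure.dirac 0 else gammaMeasure d 1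

theorem erlang_zero : erlang 0 = Measure.dirac 0 := if_pos rfl

theorem erlang_succ (d : ℕ) : erlang (d + 1) = gammaMeasure (d + 1) 1 := by
  simp [erlang]

theorem erlang_one : erlang 1 = expMeasure 1 := by simp [erlang, expMeasure]

instance isProbabilityMeasure_erlang (d : ℕ) : IsProbabilityMeasure (erlang d) := by
  rcases d with _ | d
  · rw [erlang_zero]; infer_instance
  · rw [erlang_succ]; exact isProbabilityMeasure_gammaMeasure (by positivity) one_pos

theorem erlang_conv_expMeasure (d : ℕ) : (erlang d).conv (expMeasure 1) = erlang (d + 1) := by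
  rcases d with _ | d
  · rw [erlang_zero, Measure.dirac_zero_conv, erlang_one]
  · refine Measure.ext_of_lintegral _ fun f hf => ?_
    rw [Measure.lintegral_conv hf, erlang_succ, erlang_succ]
    -- Only the second coordinate of the change of variables, the total, is tested here.
    have := lintegral_gamma_exp_log_ratio d (g := fun _ w => f w) (hf.comp measurable_snd)
    simpa using this

theorem erlang_conv_erlang (a b : ℕ) : (erlang a).conv (erlang b) = erlang (a + b) := by
  induction b with
  | zero => rw [erlang_zero, Measure.conv_dirac_zero, add_zero]
  | succ b ih =>
    rw [← erlang_conv_expMeasure b, ← Measure.conv_assoc, ih, erlang_conv_expMeasure, add_assoc]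

section

variable {Ω : Type*} [MeasurableSpace Ω] {μ : Measure Ω} [IsProbabilityMeasure μ]

theorem hasLaw_sum_erlang {ι : Type*} {Y : ι → Ω → ℝ} {d : ι → ℕ}
    (hY : ∀ i, HasLaw (Y i) (erlang (d i)) μ) (hind : iIndepFun Y μ) (s : Finset ι) :
    HasLaw (fun ω => ∑ i ∈ s, Y i ω) (erlang (∑ i ∈ s, d i)) μ := by
  classical
  induction s using Finset.induction_on with
  | empty =>
    simp only [Finset.sum_empty, erlang_zero]
    exact hasLaw_dirac_of_ae_eq (Filter.EventuallyEq.rfl)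
  | insert i s hi ih =>
    simp only [Finset.sum_insert hi]
    rw [add_comm, ← erlang_conv_erlang]
    have h := hind.indepFun_finsetSum_of_notMem₀ (fun i => (hY i).aemeasurable) hi
    have h' : IndepFun (fun ω => ∑ i ∈ s, Y i ω) (Y i) μ := by
      convert h using 1
      ext ω; simp
    have := h'.hasLaw_fun_add ih (hY i)
    simpa [add_comm] using this

open Set in
theorem map_two_mul_erlang (d : ℕ) :
    (erlang d).map (fun x => 2 * x) = BlockCensoring.chiSquared (2 * d) := by
  rcases d with _ | d
  · rw [erlang_zero, Measure.map_dirac' (by fun_prop : Measurable fun x : ℝ => 2 * x)]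
    simp [BlockCensoring.chiSquared]
  · refine Measure.ext_of_lintegral _ fun f hf => ?_
    rw [lintegral_map hf (by fun_prop), erlang_succ, lintegral_gammaMeasure_nat,
      BlockCensoring.chiSquared, if_neg (by positivity)]
    have h1 : ((2 * (d + 1) : ℕ) : ℝ) / 2 = d + 1 := by push_cast; ring
    have himg : (fun x : ℝ => 2 * x) '' Ioi 0 = Ioi 0 := by
      ext x
      constructor
      · rintro ⟨z, hz, rfl⟩; simpa using hz
      · intro hx; exact ⟨x / 2, by simpa using hx, by ring⟩
    have h2 : ∫⁻ x, f x ∂gammaMeasure (d + 1) (1 / 2) = ∫⁻ x in Ioi 0,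
        ENNReal.ofReal ((1 / 2) ^ (d + 1) * x ^ d / d.factorial * Real.exp (-(x / 2))) * f x := by
      rw [gammaMeasure, lintegral_withDensity_eq_lintegral_mul_non_measurable _
        (f := gammaPDF (d + 1) (1 / 2)) (measurable_gammaPDFReal _ _).ennreal_ofReal
        (by simp [gammaPDF]), ← lintegral_indicator measurableSet_Ioi]
      refine lintegral_congr_ae ?_
      filter_upwards [compl_mem_ae_iff.mpr (measure_singleton (0 : ℝ))] with x hx
      rcases lt_or_gt_of_ne hx with h | h
      · simp [indicator, h.not_gt, gammaPDF_of_neg h]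
      · simp only [Pi.mul_apply, gammaPDF_of_nonneg h.le, indicator, mem_Ioi, h, if_true]
        congr 2
        rw [Real.Gamma_nat_eq_factorial, add_sub_cancel_right, Real.rpow_natCast,
          show (d : ℝ) + 1 = ((d + 1 : ℕ) : ℝ) by push_cast; ring, Real.rpow_natCast]
        ring_nf
    rw [h1, h2]
    conv_rhs => rw [← himg]
    rw [lintegral_image_eq_lintegral_deriv_mul_of_monotoneOn measurableSet_Ioi
      (f' := fun _ => (2 : ℝ))]
    · refine setLIntegral_congr_fun measurableSet_Ioi fun x hx => ?_
      have hx' : (0 : ℝ) < x := hx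
      rw [← mul_assoc, ← ENNReal.ofReal_mul (by positivity)]
      congr 2
      rw [mul_div_cancel_left₀ x two_ne_zero, mul_pow, pow_succ, one_div, inv_pow]
      field_simp
    · intro z _
      simpa using ((hasDerivAt_id z).const_mul (2 : ℝ)).hasDerivWithinAt
    · intro x _ y _ hxy
      beta_reduce
      linarith

/-! ### Ratios of successive partial sums of exponential variables -/

/-- The partial sums of a sequence that is indexed from `1`. -/
noncomputable def partialSum (v : ℕ → ℝ) (j : ℕ) : ℝ := ∑ l ∈ Finset.Icc 1 j, v l

/-- The scaled logarithms of the ratios of successive partial sums. -/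
noncomputable def logRatio (v : ℕ → ℝ) (j : ℕ) : ℝ :=
  j * Real.log (partialSum v (j + 1) / partialSum v j)

theorem partialSum_succ (v : ℕ → ℝ) (j : ℕ) :
    partialSum v (j + 1) = partialSum v j + v (j + 1) := by
  rw [partialSum, Finset.sum_Icc_succ_top (by lia)]; rfl

theorem partialSum_congr {v w : ℕ → ℝ} {m : ℕ} (h : ∀ l, 1 ≤ l → l ≤ m → v l = w l) {j : ℕ}
    (hj : j ≤ m) : partialSum v j = partialSum w j := by
  refine Finset.sum_congr rfl fun l hl => ?_
  rw [Finset.mem_Icc] at hl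
  exact h l hl.1 (hl.2.trans hj)

theorem logRatio_congr {v w : ℕ → ℝ} {m : ℕ} (h : ∀ l, 1 ≤ l → l ≤ m → v l = w l) {j : ℕ}
    (hj : j + 1 ≤ m) : logRatio v j = logRatio w j := by
  rw [logRatio, logRatio, partialSum_congr h hj, partialSum_congr h (by lia)]

@[fun_prop]
theorem measurable_partialSum (j : ℕ) : Measurable fun v => partialSum v j := by
  unfold partialSum; fun_prop

@[fun_prop]
theorem measurable_logRatio (j : ℕ) : Measurable fun v => logRatio v j := by
  unfold logRatio; fun_prop

/-- The sequence with prescribed terms `1, …, m`, continued by `0`. -/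
noncomputable def extendSeq (m : ℕ) (y : Fin m → ℝ) (l : ℕ) : ℝ :=
  if hl : 1 ≤ l ∧ l ≤ m then y ⟨l - 1, by lia⟩ else 0

theorem extendSeq_eq (m : ℕ) (v : ℕ → ℝ) (l : ℕ) (h1 : 1 ≤ l) (h2 : l ≤ m) :
    extendSeq m (fun j => v (j + 1)) l = v l := by
  rw [extendSeq, dif_pos ⟨h1, h2⟩]
  simp [Nat.sub_add_cancel h1]

@[fun_prop]
theorem measurable_extendSeq (m : ℕ) : Measurable (extendSeq m) := by
  refine measurable_pi_lambda _ fun l => ?_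
  by_cases hl : 1 ≤ l ∧ l ≤ m
  · simp only [extendSeq, dif_pos hl]; fun_prop
  · simp only [extendSeq, dif_neg hl]; fun_prop

/-- Padding the first `m` variables with zeros makes them a single sequence-valued variable, to
which `partialSum` and `logRatio` apply directly. -/
theorem indepFun_truncate_last {V : ℕ → Ω → ℝ} {m : ℕ} (hV : ∀ j, AEMeasurable (V j) μ)
    (hind : iIndepFun (fun j : Fin (m + 1) => V (j + 1)) μ) :
    IndepFun (fun ω l => if 1 ≤ l ∧ l ≤ m then V l ω else 0) (V (m + 1)) μ := by
  classical
  have h := hind.indepFun_finset₀ {Fin.last m}ᶜ {Fin.last m}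
    (disjoint_compl_left) (fun i => hV _)
  let φ : (({Fin.last m}ᶜ : Finset (Fin (m + 1))) → ℝ) → ℕ → ℝ := fun y =>
    extendSeq m fun j => y ⟨j.castSucc, by simp⟩
  have hφ : Measurable φ := (measurable_extendSeq m).comp (by fun_prop)
  have hψ : Measurable fun y : (({Fin.last m} : Finset (Fin (m + 1))) → ℝ) =>
    y ⟨Fin.last m, by simp⟩ := measurable_pi_apply _
  have h2 := h.comp hφ hψ
  convert h2 using 1
  · ext ω l
    by_cases hl : 1 ≤ l ∧ l ≤ m
    · simp [φ, extendSeq, hl, Nat.sub_add_cancel hl.1]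
    · simp [φ, extendSeq, hl]
  · rfl

/-- For independent standard exponential `V 1, …, V (m + 1)` the logarithms of the ratios of
successive partial sums are, after scaling, independent standard exponential, and they are
independent of the total. -/
theorem lintegral_prod_logRatio {V : ℕ → Ω → ℝ} (hV : ∀ j, AEMeasurable (V j) μ) (m : ℕ)
    (hlaw : ∀ j, 1 ≤ j → j ≤ m + 1 → HasLaw (V j) (expMeasure 1) μ)
    (hind : iIndepFun (fun j : Fin (m + 1) => V (j + 1)) μ)
    {f : ℕ → ℝ → ENNReal} (hf : ∀ j, Measurable (f j)) {g : ℝ → ENNReal} (hg : Measurable g) :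
    ∫⁻ ω, (∏ j ∈ Finset.range m, f j (logRatio (fun l => V l ω) (j + 1))) *
        g (partialSum (fun l => V l ω) (m + 1)) ∂μ =
      (∏ j ∈ Finset.range m, ∫⁻ x, f j x ∂expMeasure 1) * ∫⁻ w, g w ∂erlang (m + 1) := by
  induction m generalizing g with
  | zero =>
    simp only [Finset.range_zero, Finset.prod_empty, one_mul, zero_add, erlang_one]
    rw [← (hlaw 1 le_rfl (by simp)).lintegral_comp hg.aemeasurable]
    simp [partialSum]
  | succ m ih =>
    have hind' : iIndepFun (fun j : Fin (m + 1) => V (j + 1)) μ :=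
      hind.precomp (g := Fin.castSucc) (Fin.castSucc_injective _)
    have hi := indepFun_truncate_last hV hind
    set N : Ω → ℕ → ℝ := fun ω l => if 1 ≤ l ∧ l ≤ m + 1 then V l ω else 0
    have hN : AEMeasurable N μ := by
      refine aemeasurable_pi_lambda _ fun l => ?_
      by_cases hl : 1 ≤ l ∧ l ≤ m + 1
      · simpa only [N, hl, and_self, if_true] using hV l
      · simp only [N, hl, if_false]; fun_prop
    have hNV (ω : Ω) (l : ℕ) (h1 : 1 ≤ l) (h2 : l ≤ m + 1) : N ω l = V l ω := by simp [N, h1, h2]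
    let Φ : (ℕ → ℝ) × ℝ → ENNReal := fun p =>
      (∏ j ∈ Finset.range m, f j (logRatio p.1 (j + 1))) *
      (f m ((m + 1) * Real.log ((partialSum p.1 (m + 1) + p.2) / partialSum p.1 (m + 1))) *
        g (partialSum p.1 (m + 1) + p.2))
    have hΦ : Measurable Φ := by
      refine Measurable.mul ?_ (Measurable.mul ?_ ?_)
      · refine Finset.measurable_prod _ fun j _ => ?_
        exact (hf j).comp (by fun_prop)
      · exact (hf m).comp (by fun_prop)
      · exact hg.comp (by fun_prop)
    have h1 : ∀ ω, (∏ j ∈ Finset.range (m + 1), f j (logRatio (fun l => V l ω) (j + 1))) *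
        g (partialSum (fun l => V l ω) (m + 1 + 1)) = Φ (N ω, V (m + 1 + 1) ω) := by
      intro ω
      simp only [Φ]
      rw [Finset.prod_range_succ, mul_assoc, partialSum_succ,
        partialSum_congr (hNV ω) le_rfl]
      congr 1
      · refine Finset.prod_congr rfl fun j hj => ?_
        rw [Finset.mem_range] at hj
        rw [logRatio_congr (hNV ω) (by lia)]
      · rw [logRatio, partialSum_succ]
        push_cast
        rfl
    simp_rw [h1]
    have hl := hlaw (m + 1 + 1) (by lia) le_rfl
    have h2 : ∫⁻ ω, Φ (N ω, V (m + 1 + 1) ω) ∂μ = ∫⁻ ω, ∫⁻ y, Φ (N ω, y) ∂expMeasure 1 ∂μ := by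
      have hp := hi.map_prod_eq_prod_map_map hN (hV _)
      rw [← lintegral_map' (f := Φ) (g := fun ω => (N ω, V (m + 1 + 1) ω)) hΦ.aemeasurable
        (hN.prodMk (hV _)), hp, hl.map_eq, lintegral_prod _ hΦ.aemeasurable,
        lintegral_map' (f := fun v => ∫⁻ y, Φ (v, y) ∂expMeasure 1)
          hΦ.lintegral_prod_right'.aemeasurable hN]
    rw [h2]
    -- Integrating out the newest variable leaves a function of the previous total only. The
    -- induction hypothesis is applied with `h` in the role of `g`.
    let h : ℝ → ENNReal := fun w => ∫⁻ y, f m ((m + 1) * Real.log ((w + y) / w)) * g (w + y)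
      ∂expMeasure 1
    have hh : Measurable h := by
      refine Measurable.lintegral_prod_right (f := fun w y =>
        f m ((m + 1) * Real.log ((w + y) / w)) * g (w + y)) ?_
      exact ((hf m).comp (by fun_prop)).mul (hg.comp (by fun_prop))
    have h3 : ∀ ω, ∫⁻ y, Φ (N ω, y) ∂expMeasure 1 =
        (∏ j ∈ Finset.range m, f j (logRatio (fun l => V l ω) (j + 1))) *
          h (partialSum (fun l => V l ω) (m + 1)) := by
      intro ω
      simp only [Φ, h]
      rw [lintegral_const_mul, partialSum_congr (hNV ω) le_rfl]
      · congr 1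
        refine Finset.prod_congr rfl fun j hj => ?_
        rw [Finset.mem_range] at hj
        rw [logRatio_congr (hNV ω) (by lia)]
      · exact ((hf m).comp (by fun_prop)).mul (hg.comp (by fun_prop))
    simp_rw [h3]
    rw [ih (fun j h1 h2 => hlaw j h1 (by lia)) hind' hh, Finset.prod_range_succ, mul_assoc]
    congr 1
    have h4 := lintegral_gamma_exp_log_ratio m (g := fun d w => f m d * g w)
      (((hf m).comp measurable_fst).mul (hg.comp measurable_snd))
    rw [erlang_succ, erlang_succ]
    simp only [h]
    push_cast
    rw [h4, ← lintegral_const_mul _ hg]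
    refine lintegral_congr fun w => ?_
    rw [lintegral_mul_const _ (hf m)]

theorem hasLaw_logRatio_partialSum {V : ℕ → Ω → ℝ} (hV : ∀ j, AEMeasurable (V j) μ) (m : ℕ)
    (hlaw : ∀ j, 1 ≤ j → j ≤ m + 1 → HasLaw (V j) (expMeasure 1) μ)
    (hind : iIndepFun (fun j : Fin (m + 1) => V (j + 1)) μ) :
    HasLaw (fun ω => ((fun j : Fin m => logRatio (fun l => V l ω) (j + 1)),
        partialSum (fun l => V l ω) (m + 1)))
      ((Measure.pi fun _ => expMeasure 1).prod (erlang (m + 1))) μ := by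
  have hVm : AEMeasurable (fun ω l => V l ω) μ := aemeasurable_pi_lambda _ hV
  have hmeas : AEMeasurable (fun ω => ((fun j : Fin m => logRatio (fun l => V l ω) (j + 1)),
        partialSum (fun l => V l ω) (m + 1))) μ :=
    (aemeasurable_pi_lambda _ fun j : Fin m =>
      (measurable_logRatio (j + 1)).comp_aemeasurable hVm).prodMk
      ((measurable_partialSum (m + 1)).comp_aemeasurable hVm)
  refine ⟨hmeas, ?_⟩
  have hbox : ∀ (s : Fin m → Set ℝ) (t : Set ℝ), (∀ i, MeasurableSet (s i)) → MeasurableSet t →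
      μ.map (fun ω => ((fun j : Fin m => logRatio (fun l => V l ω) (j + 1)),
        partialSum (fun l => V l ω) (m + 1))) ((Set.univ.pi s) ×ˢ t) =
      (∏ i, expMeasure 1 (s i)) * erlang (m + 1) t := by
    intro s t hs ht
    have h := lintegral_prod_logRatio hV m hlaw hind
      (f := fun j => if hj : j < m then (s ⟨j, hj⟩).indicator 1 else 0)
      (fun j => by
        by_cases hj : j < m
        · simp only [hj, dif_pos]; exact measurable_one.indicator (hs _)
        · simp only [hj, dif_neg, not_false_eq_true]; exact measurable_zero)
      (g := t.indicator 1) (measurable_one.indicator ht)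
    rw [lintegral_indicator_one ht, Finset.prod_range, ] at h
    simp only [Fin.is_lt, dif_pos, Fin.eta, lintegral_indicator_one (hs _)] at h
    rw [← h, Measure.map_apply_of_aemeasurable hmeas ((MeasurableSet.univ_pi hs).prod ht),
      ← lintegral_indicator_one₀ (hmeas.nullMeasurable ((MeasurableSet.univ_pi hs).prod ht))]
    refine lintegral_congr fun ω => ?_
    rw [Finset.prod_range]
    have hmem : ω ∈ (fun ω => ((fun j : Fin m => logRatio (fun l => V l ω) (j + 1)),
        partialSum (fun l => V l ω) (m + 1))) ⁻¹' ((Set.univ.pi s) ×ˢ t) ↔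
        (∀ i : Fin m, logRatio (fun l => V l ω) (i + 1) ∈ s i) ∧
          partialSum (fun l => V l ω) (m + 1) ∈ t := by
      simp [Set.mem_prod]
    classical
    refine ((Set.indicator_apply _ _ _).trans (if_congr hmem rfl rfl)).trans ?_
    simp only [Fin.is_lt, dif_pos, Fin.eta, Set.indicator, Pi.one_apply]
    by_cases h1 : ∀ i : Fin m, logRatio (fun l => V l ω) (i + 1) ∈ s i
    · simp [h1]
    · rw [if_neg (fun h => h1 h.1)]
      push Not at h1
      obtain ⟨i, hi⟩ := h1
      rw [Finset.prod_eq_zero (Finset.mem_univ i) (by rw [if_neg hi]), zero_mul]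
  -- The product formula on boxes determines the joint law, since boxes form a generating π-system.
  refine (Measure.prod_eq_generateFrom
    (C := Set.univ.pi '' Set.univ.pi fun _ : Fin m => {s : Set ℝ | MeasurableSet s})
    (D := {t : Set ℝ | MeasurableSet t}) generateFrom_pi MeasurableSpace.generateFrom_measurableSet
    isPiSystem_pi MeasurableSpace.isPiSystem_measurableSet
    ⟨fun _ => Set.univ, fun _ => ⟨fun _ => Set.univ,
      fun _ _ => by rw [Set.mem_ofPred_eq]; exact .univ, Set.pi_univ _⟩,
      fun _ => measure_lt_top _ _, Set.iUnion_const _⟩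
    ⟨fun _ => Set.univ, fun _ => by rw [Set.mem_ofPred_eq]; exact .univ,
      fun _ => measure_lt_top _ _,
      Set.iUnion_const _⟩ ?_).symm
  rintro _ ⟨s, hs, rfl⟩ t ht
  rw [hbox s t (fun i => hs i (Set.mem_univ i)) ht, Measure.pi_pi]

theorem hasLaw_sum_logRatio {V : ℕ → Ω → ℝ} (hV : ∀ j, AEMeasurable (V j) μ) (m : ℕ)
    (hlaw : ∀ j, 1 ≤ j → j ≤ m + 1 → HasLaw (V j) (expMeasure 1) μ)
    (hind : iIndepFun (fun j : Fin (m + 1) => V (j + 1)) μ) :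
    HasLaw (fun ω => ∑ j ∈ Finset.Icc 1 m, logRatio (fun l => V l ω) j) (erlang m) μ := by
  have h := hasLaw_logRatio_partialSum hV m hlaw hind
  have h1 : HasLaw (fun ω (j : Fin m) => logRatio (fun l => V l ω) (j + 1))
      (Measure.pi fun _ => expMeasure 1) μ :=
    (measurePreserving_fst (ν := erlang (m + 1))).fun_comp_hasLaw h
  have h2 : HasLaw (fun y : Fin m → ℝ => ∑ j, y j) (erlang m)
      (Measure.pi fun _ => expMeasure 1) := by
    have := hasLaw_sum_erlang (Y := fun (j : Fin m) (y : Fin m → ℝ) => y j) (d := fun _ => 1)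
      (μ := Measure.pi fun _ => expMeasure 1)
      (fun i => by
        rw [erlang_one]
        exact (measurePreserving_eval (fun _ : Fin m => expMeasure 1) i).hasLaw)
      (iIndepFun_pi (X := fun _ x => x) fun _ => aemeasurable_id) Finset.univ
    simpa using this
  have h3 := h2.fun_comp h1
  convert h3 using 2 with ω
  rw [Fin.sum_univ_eq_sum_range (fun j => logRatio (fun l => V l ω) (j + 1)) m,
    Finset.range_eq_Ico, Finset.sum_Ico_add' (fun j => logRatio (fun l => V l ω) j) 0 m 1]
  rfl

theorem indepFun_logRatio_partialSum {V : ℕ → Ω → ℝ} (hV : ∀ j, AEMeasurable (V j) μ) (m : ℕ)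
    (hlaw : ∀ j, 1 ≤ j → j ≤ m + 1 → HasLaw (V j) (expMeasure 1) μ)
    (hind : iIndepFun (fun j : Fin (m + 1) => V (j + 1)) μ) :
    IndepFun (fun ω (j : Fin m) => logRatio (fun l => V l ω) (j + 1))
      (fun ω => partialSum (fun l => V l ω) (m + 1)) μ := by
  have h := hasLaw_logRatio_partialSum hV m hlaw hind
  exact (indepFun_iff_hasLaw_prodMk_prod (measurePreserving_fst.fun_comp_hasLaw h)
    (measurePreserving_snd.fun_comp_hasLaw h)).2 h

theorem hasLaw_partialSum {V : ℕ → Ω → ℝ} (hV : ∀ j, AEMeasurable (V j) μ) (m : ℕ)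
    (hlaw : ∀ j, 1 ≤ j → j ≤ m + 1 → HasLaw (V j) (expMeasure 1) μ)
    (hind : iIndepFun (fun j : Fin (m + 1) => V (j + 1)) μ) :
    HasLaw (fun ω => partialSum (fun l => V l ω) (m + 1)) (erlang (m + 1)) μ :=
  measurePreserving_snd.fun_comp_hasLaw (hasLaw_logRatio_partialSum hV m hlaw hind)

end

namespace BlockCensoring

/-! ### Combinatorics of the set of units on test -/

section Survivors

variable {n : ℕ}

theorem exists_firstFailure_eq (x : Fin n → ℝ) {A : Finset (Fin n)} (hA : A.Nonempty) :
    ∃ u ∈ A, firstFailure x A = x u ∧ ∀ v ∈ A, x u ≤ x v := by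
  obtain ⟨u, hu, h⟩ := A.exists_mem_eq_inf' hA x
  refine ⟨u, hu, by rw [firstFailure, dif_pos hA, h], fun v hv => ?_⟩
  rw [← h]
  exact Finset.inf'_le x hv

theorem firstFailure_eq_of_le {x : Fin n → ℝ} {A : Finset (Fin n)} {u : Fin n} (hu : u ∈ A)
    (h : ∀ v ∈ A, x u ≤ x v) : firstFailure x A = x u := by
  rw [firstFailure, dif_pos ⟨u, hu⟩]
  exact le_antisymm (Finset.inf'_le x hu) (Finset.le_inf' _ _ h)

theorem withdraw_subset (s : Equiv.Perm (Fin n)) (r : ℕ) (B : Finset (Fin n)) :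
    withdraw s r B ⊆ B := Finset.filter_subset _ _

/-- The rank of a unit within `B` is injective on `B` with image `{0, …, B.card - 1}`, and the
remaining units are those of rank at least `r`. -/
theorem card_withdraw (s : Equiv.Perm (Fin n)) (r : ℕ) (B : Finset (Fin n)) :
    (withdraw s r B).card = B.card - r := by
  set rank : Fin n → ℕ := fun u => (B.filter fun v => s v < s u).card
  have hlt : ∀ u ∈ B, ∀ v, s u < s v → rank u < rank v := by
    intro u hu v huv
    refine Finset.card_lt_card (Finset.ssubset_iff_of_subset ?_ |>.2 ⟨u, ?_, ?_⟩)
    · intro w hw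
      rw [Finset.mem_filter] at hw ⊢
      exact ⟨hw.1, hw.2.trans huv⟩
    · simp [hu, huv]
    · simp
  have hinj : Set.InjOn rank B := by
    intro u hu v hv h
    rcases lt_trichotomy (s u) (s v) with h1 | h1 | h1
    · exact absurd h (hlt u hu v h1).ne
    · exact s.injective h1
    · exact absurd h (hlt v hv u h1).ne'
  have himg : B.image rank = Finset.range B.card := by
    refine Finset.eq_of_subset_of_card_le ?_ ?_
    · intro k hk
      obtain ⟨u, hu, rfl⟩ := Finset.mem_image.1 hk
      rw [Finset.mem_range]
      refine Finset.card_lt_card (Finset.ssubset_iff_of_subset (Finset.filter_subset _ _) |>.2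
        ⟨u, hu, by simp⟩)
    · rw [Finset.card_range, Finset.card_image_of_injOn hinj]
  have h : (withdraw s r B).image rank = Finset.Ico r B.card := by
    rw [withdraw, ← Finset.filter_image (p := fun k => r ≤ k), himg]
    ext k; simp; tauto
  rw [← Finset.card_image_of_injOn (hinj.mono (by exact_mod_cast withdraw_subset s r B)), h,
    Nat.card_Ico]

/-- The units on test after the `l`-th failure, if those in `A` are on test before it. -/
noncomputable def step (R : ℕ → ℕ) (τ : ℝ) (s : ℕ → Equiv.Perm (Fin n)) (x : Fin n → ℝ) (l : ℕ)
    (A : Finset (Fin n)) : Finset (Fin n) :=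
  if firstFailure x A < τ then withdraw (s l) (R l) (A.filter fun u => firstFailure x A < x u)
  else A.filter fun u => firstFailure x A < x u

/-- The units on test after `j` failures. -/
noncomputable def survivors (R : ℕ → ℕ) (τ : ℝ) (s : ℕ → Equiv.Perm (Fin n)) (x : Fin n → ℝ) :
    ℕ → Finset (Fin n)
  | 0 => Finset.univ
  | j + 1 => step R τ s x (j + 1) (survivors R τ s x j)

theorem onTest_eq_survivors (c : Plan) (s : ℕ → Equiv.Perm (Fin c.n)) (x : Fin c.n → ℝ) (j : ℕ) :
    onTest c s x j = survivors c.R c.τ s x j := by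
  induction j with
  | zero => rfl
  | succ j ih => rw [onTest, survivors, step, ih]

variable {R : ℕ → ℕ} {τ : ℝ} {s : ℕ → Equiv.Perm (Fin n)} {x : Fin n → ℝ} {l : ℕ}
  {A : Finset (Fin n)}

theorem step_subset_filter :
    step R τ s x l A ⊆ A.filter fun u => firstFailure x A < x u := by
  rw [step]
  split_ifs
  · exact withdraw_subset _ _ _
  · exact subset_rfl

theorem filter_lt_eq_erase {u : Fin n} (h : ∀ v ∈ A, v ≠ u → x u < x v) :
    (A.filter fun v => x u < x v) = A.erase u := by
  ext v
  rw [Finset.mem_filter, Finset.mem_erase]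
  constructor
  · rintro ⟨h1, h2⟩
    exact ⟨fun h => by simp [h] at h2, h1⟩
  · rintro ⟨h1, h2⟩
    exact ⟨h2, h v h2 h1⟩

theorem step_of_argmin {u : Fin n} (hu : u ∈ A) (h : ∀ v ∈ A, v ≠ u → x u < x v) :
    step R τ s x l A =
      if x u < τ then withdraw (s l) (R l) (A.erase u) else A.erase u := by
  have hff : firstFailure x A = x u := firstFailure_eq_of_le hu fun v hv => by
    by_cases hvu : v = u
    · rw [hvu]
    · exact (h v hv hvu).le
  rw [step, hff, filter_lt_eq_erase h]

theorem card_step (hx : Function.Injective x) (hA : A.Nonempty) :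
    (step R τ s x l A).card =
      A.card - 1 - if firstFailure x A < τ then R l else 0 := by
  obtain ⟨u, hu, hff, hmin⟩ := exists_firstFailure_eq x hA
  rw [step_of_argmin hu fun v hv hvu => lt_of_le_of_ne (hmin v hv) fun h => hvu (hx h.symm), hff]
  split_ifs
  · rw [card_withdraw, Finset.card_erase_of_mem hu]
  · rw [Finset.card_erase_of_mem hu, Nat.sub_zero]

/-- Balance of units: on test, failed and withdrawn add up to `n`. The truncated subtraction in
`card_step` loses nothing, because the plan reserves enough units for all later failures and
withdrawals. -/
theorem card_survivors_add (hx : Function.Injective x) {m : ℕ}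
    (hm : m + ∑ j ∈ Finset.Icc 1 m, R j = n) {j : ℕ} (hj : j ≤ m) :
    (survivors R τ s x j).card + j +
      ∑ l ∈ Finset.Icc 1 j, (if firstFailure x (survivors R τ s x (l - 1)) < τ then R l else 0) =
        n := by
  induction j with
  | zero => simp [survivors]
  | succ j ih =>
    have ih := ih (by lia)
    have h1 : ∑ l ∈ Finset.Icc 1 j,
        (if firstFailure x (survivors R τ s x (l - 1)) < τ then R l else 0) ≤
        ∑ l ∈ Finset.Icc 1 j, R l := Finset.sum_le_sum fun l _ => by split_ifs <;> simp
    have h2 : ∑ l ∈ Finset.Icc 1 (j + 1), R l ≤ ∑ l ∈ Finset.Icc 1 m, R l :=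
      Finset.sum_le_sum_of_subset (Finset.Icc_subset_Icc_right hj)
    rw [Finset.sum_Icc_succ_top (by lia)] at h2
    have hpos : 0 < (survivors R τ s x j).card := by lia
    rw [Finset.sum_Icc_succ_top (by lia), survivors, card_step hx (Finset.card_pos.1 hpos),
      Nat.add_sub_cancel]
    split_ifs <;> lia

theorem survivors_nonempty (hx : Function.Injective x) {m : ℕ}
    (hm : m + ∑ j ∈ Finset.Icc 1 m, R j = n) {j : ℕ} (hj : j < m) :
    (survivors R τ s x j).Nonempty := by
  have h := card_survivors_add (τ := τ) (s := s) hx hm hj.le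
  have h1 : ∑ l ∈ Finset.Icc 1 j,
      (if firstFailure x (survivors R τ s x (l - 1)) < τ then R l else 0) ≤
      ∑ l ∈ Finset.Icc 1 j, R l := Finset.sum_le_sum fun l _ => by split_ifs <;> simp
  have h2 : ∑ l ∈ Finset.Icc 1 j, R l ≤ ∑ l ∈ Finset.Icc 1 m, R l :=
    Finset.sum_le_sum_of_subset (Finset.Icc_subset_Icc_right hj.le)
  rw [← Finset.card_pos]
  lia

theorem firstFailure_survivors_lt (hx : Function.Injective x) {m : ℕ}
    (hm : m + ∑ j ∈ Finset.Icc 1 m, R j = n) {j : ℕ} (hj : j + 1 < m) :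
    firstFailure x (survivors R τ s x j) < firstFailure x (survivors R τ s x (j + 1)) := by
  obtain ⟨u, hu, hff, -⟩ :=
    exists_firstFailure_eq x (survivors_nonempty (τ := τ) (s := s) hx hm hj)
  rw [hff]
  have := step_subset_filter hu
  exact (Finset.mem_filter.1 this).2

/-- Lifetimes that are ordered in the same way lead to the same experiment. -/
theorem step_congr_order {y : Fin n → ℝ} {τ' : ℝ} (hxy : ∀ u v, x u < x v ↔ y u < y v)
    (hτ : ∀ u, x u < τ ↔ y u < τ') : step R τ s x l A = step R τ' s y l A := by
  -- For empty `A` both first failure times are the default `0`, which may lie on different sides of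
  -- `τ` and `τ'`; every branch yields the empty set all the same.
  rcases A.eq_empty_or_nonempty with rfl | hA
  · have h (r : ℕ) : withdraw (s l) r ∅ = ∅ := Finset.subset_empty.1 (withdraw_subset _ _ _)
    simp [step, h]
  · obtain ⟨u, hu, hff, hmin⟩ := exists_firstFailure_eq x hA
    have hffy : firstFailure y A = y u := firstFailure_eq_of_le hu fun v hv => by
      rw [← not_lt, ← hxy, not_lt]; exact hmin v hv
    simp only [step, hff, hffy, hτ, hxy]

theorem survivors_congr_order {y : Fin n → ℝ} {τ' : ℝ} (hxy : ∀ u v, x u < x v ↔ y u < y v)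
    (hτ : ∀ u, x u < τ ↔ y u < τ') (j : ℕ) : survivors R τ s x j = survivors R τ' s y j := by
  induction j with
  | zero => rfl
  | succ j ih => rw [survivors, survivors, ih, step_congr_order hxy hτ]

end Survivors

/-- A downward closed subset of `{1, …, m}` is an initial segment, hence known from its size. As
failure times increase, this is what makes `j ≤ J` equivalent to `T j < τ`. -/
theorem filter_Icc_eq_Icc_card {p : ℕ → Prop} [DecidablePred p] {m : ℕ}
    (hp : ∀ j, 1 ≤ j → j + 1 ≤ m → p (j + 1) → p j) :
    (Finset.Icc 1 m).filter p = Finset.Icc 1 ((Finset.Icc 1 m).filter p).card := by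
  induction m with
  | zero => simp
  | succ m ih =>
    by_cases h : p (m + 1)
    · have hall : ∀ d, d ≤ m → p (m + 1 - d) := by
        intro d
        induction d with
        | zero => intro _; exact h
        | succ d ihd =>
          intro hd
          have := hp (m + 1 - (d + 1)) (by lia) (by lia)
          rw [show m + 1 - (d + 1) + 1 = m + 1 - d by lia] at this
          exact this (ihd (by lia))
      have : (Finset.Icc 1 (m + 1)).filter p = Finset.Icc 1 (m + 1) := by
        refine Finset.filter_true_of_mem fun j hj => ?_
        rw [Finset.mem_Icc] at hj
        have := hall (m + 1 - j) (by lia)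
        rwa [show m + 1 - (m + 1 - j) = j by lia] at this
      simp [this]
    · have : (Finset.Icc 1 (m + 1)).filter p = (Finset.Icc 1 m).filter p := by
        ext j
        simp only [Finset.mem_filter, Finset.mem_Icc]
        refine ⟨fun hj => ⟨⟨hj.1.1, ?_⟩, hj.2⟩, fun hj => ⟨⟨hj.1.1, by lia⟩, hj.2⟩⟩
        have : j ≠ m + 1 := fun h' => h (h' ▸ hj.2)
        lia
      rw [this]
      exact ih fun j h1 h2 => hp j h1 (by lia)

/-! ### Algebraic identities between the statistics -/

section Statistics

variable (c : Plan) {α β : ℝ} {T : ℕ → ℝ}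

theorem le_J_iff (hT : ∀ j, 1 ≤ j → j + 1 ≤ c.m → T j < T (j + 1)) {l : ℕ} (h1 : 1 ≤ l)
    (h2 : l ≤ c.m) : l ≤ J c T ↔ T l < c.τ := by
  have h := filter_Icc_eq_Icc_card (p := fun j => T j < c.τ) (m := c.m)
    fun j h1 h2 h => (hT j h1 h2).trans h
  have h' : l ∈ (Finset.Icc 1 c.m).filter (fun j => T j < c.τ) ↔ l ∈ Finset.Icc 1 (J c T) := by
    rw [h]; rfl
  simpa [h1, h2] using h'.symm

theorem Γ_one : Γ c T 1 = c.n := by simp [Γ]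

theorem Γ_succ {l : ℕ} (h1 : 1 ≤ l) (h2 : l + 1 ≤ c.m) :
    Γ c T (l + 1) = Γ c T l - (r c T l + 1) := by
  -- The last-index branch of `r` is not reached since `l ≤ m - 1`. When `J ≥ m - 1`, the condition
  -- `l ≤ J` is automatic.
  have hr : r c T l = if l ≤ J c T then (c.R l : ℤ) else 0 := by
    simp only [r]
    split_ifs <;> first | rfl | lia
  rw [hr, Γ, Γ, Nat.add_sub_cancel]
  split_ifs with h
  · rw [min_eq_right h, min_eq_right (by lia : l - 1 ≤ J c T)]
    obtain ⟨k, rfl⟩ : ∃ k, l = k + 1 := ⟨l - 1, by lia⟩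
    rw [Finset.sum_Icc_succ_top (by lia), Nat.add_sub_cancel]
    push_cast
    ring
  · rw [min_eq_left (by lia), min_eq_left (by lia)]
    push_cast
    ring

theorem Γ_eq_sub_sum {j : ℕ} (h1 : 1 ≤ j) (h2 : j ≤ c.m) :
    (Γ c T j : ℝ) = c.n - ∑ l ∈ Finset.Ico 1 j, ((r c T l : ℝ) + 1) := by
  induction j, h1 using Nat.le_induction with
  | base => simp [Γ_one]
  | succ j hj ih =>
    rw [Γ_succ c hj h2, Finset.sum_Ico_succ_top hj]
    push_cast
    rw [ih (by lia)]
    ring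

/-- Summation by parts: by `Γ_succ` the coefficient left on `U l` is `Γ l - Γ (l + 1) = r l + 1`. -/
theorem W_eq_sum {j : ℕ} (h1 : 1 ≤ j) (h2 : j ≤ c.m) :
    W c α β T j = ∑ l ∈ Finset.Ico 1 j, ((r c T l : ℝ) + 1) * U α β T l + Γ c T j * U α β T j := by
  induction j, h1 using Nat.le_induction with
  | base => simp [W, V]
  | succ j hj ih =>
    have h3 : W c α β T (j + 1) = W c α β T j + V c α β T (j + 1) := partialSum_succ _ _
    rw [h3, ih (by lia), Finset.sum_Ico_succ_top hj, V, if_neg (by lia), Nat.add_sub_cancel,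
      Γ_succ c hj h2]
    push_cast
    ring

theorem W_eq_neg_mul_S (hU : ∀ j, 1 ≤ j → j ≤ c.m → U α β T j = -α * φ β T j) {j : ℕ} (h1 : 1 ≤ j)
    (h2 : j ≤ c.m) : W c α β T j = -α * S c β T j := by
  rw [W_eq_sum c h1 h2, S, Γ_eq_sub_sum c h1 h2, hU j h1 h2, mul_add, Finset.mul_sum]
  congr 1
  · refine Finset.sum_congr rfl fun l hl => ?_
    rw [Finset.mem_Ico] at hl
    rw [hU l hl.1 (by lia)]
    ring
  · ring

theorem pivot_eq_sum_log_Q (hα : 0 < α) (hU : ∀ j, 1 ≤ j → j ≤ c.m → U α β T j = -α * φ β T j) :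
    pivot c β T = -2 * ∑ j ∈ Finset.Icc 1 (c.m - 1), Real.log (Q c α β T j) := by
  rw [pivot]
  congr 1
  refine Finset.sum_congr rfl fun j hj => ?_
  rw [Finset.mem_Icc] at hj
  have := c.one_le_m
  rw [Q, W_eq_neg_mul_S c hU hj.1 (by lia), W_eq_neg_mul_S c hU c.one_le_m le_rfl,
    mul_div_mul_left _ _ (neg_ne_zero.2 hα.ne')]

theorem iepCDF_of_pos {t : ℝ} (ht : 0 < t) :
    1 - iepCDF α β t = (1 - (t / (1 + t)) ^ β) ^ α := by
  rw [iepCDF, if_pos ht]; ring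

theorem one_sub_rpow_pos (hβ : 0 < β) {t : ℝ} (ht : 0 < t) : 0 < 1 - (t / (1 + t)) ^ β := by
  have h : (t / (1 + t)) ^ β < 1 :=
    Real.rpow_lt_one (by positivity) ((div_lt_one (by positivity)).2 (by linarith)) hβ
  linarith

theorem U_eq_neg_mul_φ (hβ : 0 < β) {j : ℕ} (hT : 0 < T j) : U α β T j = -α * φ β T j := by
  rw [U, φ, iepCDF_of_pos hT, Real.log_rpow (one_sub_rpow_pos hβ hT)]
  ring

end Statistics

/-! ### Logarithms of ratios of partial sums -/

section Ratios

variable {v : ℕ → ℝ} {m : ℕ}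

theorem partialSum_pos (hv : ∀ j, 1 ≤ j → j ≤ m → 0 < v j) {j : ℕ} (h1 : 1 ≤ j) (h2 : j ≤ m) :
    0 < partialSum v j :=
  Finset.sum_pos (fun l hl => by
    rw [Finset.mem_Icc] at hl; exact hv l hl.1 (hl.2.trans h2)) ⟨1, by simp [h1]⟩

theorem sum_log_ratio_eq (hv : ∀ j, 1 ≤ j → j ≤ m + 1 → 0 < v j) :
    ∑ j ∈ Finset.Icc 1 m, Real.log (partialSum v j / partialSum v (m + 1)) =
      -∑ j ∈ Finset.Icc 1 m, logRatio v j := by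
  induction m with
  | zero => simp
  | succ m ih =>
    have hpos := fun j => partialSum_pos (j := j) hv
    have ih := ih fun j h1 h2 => hv j h1 (by lia)
    rw [Finset.sum_Icc_succ_top (by lia), Finset.sum_Icc_succ_top (by lia), neg_add, ← ih,
      logRatio, Real.log_div (hpos _ (by lia) (by lia)).ne' (hpos _ (by lia) (by lia)).ne',
      Real.log_div (hpos (m + 1 + 1) (by lia) (by lia)).ne' (hpos _ (by lia) (by lia)).ne']
    -- Replacing the total by the next one shifts each of the `m` old terms by the same logarithm.
    -- With the new top term it occurs `m + 1` times, which is the factor in `logRatio v (m + 1)`.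
    have h : ∑ j ∈ Finset.Icc 1 m,
        Real.log (partialSum v j / partialSum v (m + 1 + 1)) = ∑ j ∈ Finset.Icc 1 m,
        (Real.log (partialSum v j / partialSum v (m + 1)) +
          (Real.log (partialSum v (m + 1)) - Real.log (partialSum v (m + 1 + 1)))) := by
      refine Finset.sum_congr rfl fun j hj => ?_
      rw [Finset.mem_Icc] at hj
      rw [Real.log_div (hpos _ hj.1 (by lia)).ne' (hpos _ (by lia) (by lia)).ne',
        Real.log_div (hpos _ hj.1 (by lia)).ne' (hpos _ (by lia) (by lia)).ne']
      ring
    rw [h, Finset.sum_add_distrib, Finset.sum_const, Nat.card_Icc,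
      nsmul_eq_mul]
    push_cast
    ring

/-- Undoing the scaling by `l` makes the sum of logarithms telescope. The ratios are thus functions
of the `logRatio` variables alone. -/
theorem ratio_eq_exp_sum (hv : ∀ j, 1 ≤ j → j ≤ m + 1 → 0 < v j) {j : ℕ} (h1 : 1 ≤ j)
    (h2 : j ≤ m + 1) :
    partialSum v j / partialSum v (m + 1) =
      Real.exp (-∑ l ∈ Finset.Ico j (m + 1), logRatio v l / l) := by
  have hpos := fun j => partialSum_pos (j := j) hv
  have h : ∀ k, j ≤ k → k ≤ m + 1 → ∑ l ∈ Finset.Ico j k, logRatio v l / l =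
      Real.log (partialSum v k) - Real.log (partialSum v j) := by
    intro k hk
    induction k, hk using Nat.le_induction with
    | base => simp
    | succ k hk ih =>
      intro hkm
      have : (0 : ℝ) < k := by exact_mod_cast (by lia : 0 < k)
      rw [Finset.sum_Ico_succ_top hk, ih (by lia), logRatio, mul_div_cancel_left₀ _ this.ne',
        Real.log_div (hpos _ (by lia) (by lia)).ne' (hpos _ (by lia) (by lia)).ne']
      ring
  rw [h _ h2 le_rfl, neg_sub, Real.exp_sub, Real.exp_log (hpos _ h1 h2),
    Real.exp_log (hpos _ (by lia) le_rfl)]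

end Ratios


instance (n : ℕ) : DiscreteMeasurableSpace (Equiv.Perm (Fin n)) := ⟨fun _ => trivial⟩

/-! ### Measurability of the experiment -/

section Measurability

variable {n : ℕ} {Ω : Type*} [MeasurableSpace Ω]

theorem measurable_firstFailure_const (A : Finset (Fin n)) :
    Measurable fun x : Fin n → ℝ => firstFailure x A := by
  by_cases hA : A.Nonempty
  · simp only [firstFailure, dif_pos hA]
    have : Measurable (A.inf' hA fun (u : Fin n) (x : Fin n → ℝ) => x u) :=
      Finset.inf'_induction hA _ (fun _ hf _ hg => hf.inf hg) fun u _ => measurable_pi_apply u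
    convert this using 1
    ext x
    simp
  · simp only [firstFailure, dif_neg hA]
    exact measurable_const

theorem measurable_firstFailure {x : Ω → Fin n → ℝ} (hx : Measurable x) {A : Ω → Finset (Fin n)}
    (hA : Measurable A) : Measurable fun ω => firstFailure (x ω) (A ω) := by
  -- The set on test takes finitely many values, so measurability may be checked with the set fixed;
  -- the same device serves for `step` and `spacingProd`.
  have : Measurable fun p : (Fin n → ℝ) × Finset (Fin n) => firstFailure p.1 p.2 :=
    measurable_from_prod_countable_left fun A => measurable_firstFailure_const A
  exact this.comp (hx.prodMk hA)

theorem measurable_withdraw (r : ℕ) :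
    Measurable fun p : Equiv.Perm (Fin n) × Finset (Fin n) => withdraw p.1 r p.2 :=
  Measurable.of_discrete

theorem measurable_step_const (R : ℕ → ℕ) (τ : ℝ) (l : ℕ) {s : Ω → ℕ → Equiv.Perm (Fin n)}
    (hs : ∀ j, Measurable fun ω => s ω j) {x : Ω → Fin n → ℝ} (hx : Measurable x)
    (A : Finset (Fin n)) : Measurable fun ω => step R τ (s ω) (x ω) l A := by
  have hff : Measurable fun ω => firstFailure (x ω) A :=
    (measurable_firstFailure_const A).comp hx
  have hfilter : Measurable fun ω => A.filter fun u => firstFailure (x ω) A < x ω u := by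
    refine measurable_finset_iff.2 fun u => ?_
    have hlt : Measurable fun ω => firstFailure (x ω) A < x ω u :=
      measurableSet_setOfPred.1 (measurableSet_lt hff (measurable_pi_iff.1 hx u))
    simp only [Finset.mem_filter]
    exact measurable_const.and hlt
  have hw := (measurable_withdraw (n := n) (R l)).comp ((hs l).prodMk hfilter)
  have hset : MeasurableSet {ω | firstFailure (x ω) A < τ} := measurableSet_lt hff measurable_const
  simp only [step]
  exact Measurable.ite hset hw hfilter

theorem measurable_survivors (R : ℕ → ℕ) (τ : ℝ) {s : Ω → ℕ → Equiv.Perm (Fin n)}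
    (hs : ∀ j, Measurable fun ω => s ω j) {x : Ω → Fin n → ℝ} (hx : Measurable x) (j : ℕ) :
    Measurable fun ω => survivors R τ (s ω) (x ω) j := by
  induction j with
  | zero => exact measurable_const
  | succ j ih =>
    have : Measurable fun p : Ω × Finset (Fin n) => step R τ (s p.1) (x p.1) (j + 1) p.2 :=
      measurable_from_prod_countable_left fun A => measurable_step_const R τ (j + 1) hs hx A
    exact this.comp (measurable_id.prodMk ih)

end Measurability

/-! ### Normalized spacings for exponential lifetimes -/

section Law

variable {n : ℕ}

/-- The time between two successive failures multiplied by the number of units on test. -/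
noncomputable def spacing (R : ℕ → ℕ) (τ : ℝ) (s : ℕ → Equiv.Perm (Fin n)) (x : Fin n → ℝ)
    (j : ℕ) : ℝ :=
  (survivors R τ s x j).card * (firstFailure x (survivors R τ s x j) -
    if j = 0 then 0 else firstFailure x (survivors R τ s x (j - 1)))

theorem measurable_spacing {Ω : Type*} [MeasurableSpace Ω] (R : ℕ → ℕ) (τ : ℝ)
    {s : Ω → ℕ → Equiv.Perm (Fin n)} (hs : ∀ j, Measurable fun ω => s ω j) {x : Ω → Fin n → ℝ}
    (hx : Measurable x) (j : ℕ) : Measurable fun ω => spacing R τ (s ω) (x ω) j := by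
  have hsv := measurable_survivors R τ hs hx
  have hff (j : ℕ) := measurable_firstFailure hx (hsv j)
  have hcard : Measurable fun ω => ((survivors R τ (s ω) (x ω) j).card : ℝ) :=
    (Measurable.of_discrete (f := fun A : Finset (Fin n) => (A.card : ℝ))).comp (hsv j)
  unfold spacing
  refine hcard.mul ((hff j).sub ?_)
  split_ifs
  · exact measurable_const
  · exact hff _

/-- The product of test functions `f` of the next `k` normalized spacings, when `l` failures have
been observed, the last one at time `t`, and the units in `A` are on test. -/
noncomputable def spacingProd (R : ℕ → ℕ) (τ : ℝ) (s : ℕ → Equiv.Perm (Fin n))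
    (f : ℕ → ℝ → ENNReal) : ℕ → ℕ → Finset (Fin n) → ℝ → (Fin n → ℝ) → ENNReal
  | 0, _, _, _, _ => 1
  | k + 1, l, A, t, x => f l (A.card * (firstFailure x A - t)) *
      spacingProd R τ s f k (l + 1) (step R τ s x (l + 1) A) (firstFailure x A) x

variable {R : ℕ → ℕ} {τ : ℝ} {s : ℕ → Equiv.Perm (Fin n)} {f : ℕ → ℝ → ENNReal}

/-- The recursive form exposes the state, namely the set on test and the last failure time, on which
the induction conditions. -/
theorem prod_spacing_eq_spacingProd (x : Fin n → ℝ) (k l : ℕ) :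
    ∏ i ∈ Finset.range k, f (l + i) (spacing R τ s x (l + i)) =
      spacingProd R τ s f k l (survivors R τ s x l)
        (if l = 0 then 0 else firstFailure x (survivors R τ s x (l - 1))) x := by
  induction k generalizing l with
  | zero => simp [spacingProd]
  | succ k ih =>
    have ih := ih (l + 1)
    rw [if_neg (by lia), Nat.add_sub_cancel] at ih
    rw [Finset.prod_range_succ', spacingProd, mul_comm, ← survivors, ← ih]
    congr 1
    refine Finset.prod_congr rfl fun i _ => ?_
    rw [show l + (i + 1) = l + 1 + i by lia]

theorem measurable_spacingProd (hf : ∀ j, Measurable (f j)) (k l : ℕ) (A : Finset (Fin n)) :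
    Measurable fun p : ℝ × (Fin n → ℝ) => spacingProd R τ s f k l A p.1 p.2 := by
  induction k generalizing l A with
  | zero => exact measurable_const
  | succ k ih =>
    have hff : Measurable fun p : ℝ × (Fin n → ℝ) => firstFailure p.2 A :=
      (measurable_firstFailure_const A).comp measurable_snd
    simp only [spacingProd]
    refine Measurable.mul ((hf l).comp ((hff.sub measurable_fst).const_mul _)) ?_
    have h : Measurable fun p : (ℝ × (Fin n → ℝ)) × Finset (Fin n) =>
        spacingProd R τ s f k (l + 1) p.2 p.1.1 p.1.2 :=
      measurable_from_prod_countable_left fun A => ih (l + 1) A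
    exact h.comp ((hff.prodMk measurable_snd).prodMk (measurable_step_const R τ (l + 1)
      (s := fun _ => s) (fun _ => measurable_const) measurable_snd A))

theorem firstFailure_congr {x y : Fin n → ℝ} {A : Finset (Fin n)} (h : ∀ v ∈ A, x v = y v) :
    firstFailure x A = firstFailure y A := by
  rw [firstFailure, firstFailure]
  split_ifs with hA
  · exact Finset.inf'_congr hA rfl h
  · rfl

theorem step_congr {x y : Fin n → ℝ} {A : Finset (Fin n)} (l : ℕ) (h : ∀ v ∈ A, x v = y v) :
    step R τ s x l A = step R τ s y l A := by
  have hfil : (A.filter fun u => firstFailure x A < x u) =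
      A.filter fun u => firstFailure y A < y u :=
    Finset.filter_congr fun v hv => by rw [firstFailure_congr h, h v hv]
  rw [step, step, hfil, firstFailure_congr h]

/-- The future of the experiment depends only on units still on test; the lifetime of a failed unit
can therefore be altered freely. -/
theorem spacingProd_congr {x y : Fin n → ℝ} (k l : ℕ) {A : Finset (Fin n)} (t : ℝ)
    (h : ∀ v ∈ A, x v = y v) :
    spacingProd R τ s f k l A t x = spacingProd R τ s f k l A t y := by
  induction k generalizing l A t with
  | zero => rfl
  | succ k ih =>
    rw [spacingProd, spacingProd, firstFailure_congr h, ← step_congr (l + 1) h]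
    congr 1
    refine ih _ _ fun v hv => h v ?_
    exact Finset.filter_subset _ _ (step_subset_filter hv)

-- Resampling one coordinate preserves the product law. This isolates the lifetime of a chosen unit
-- without splitting the index set.
open Function in
theorem measurePreserving_update (u : Fin n) :
    MeasurePreserving (fun p : (Fin n → ℝ) × ℝ => update p.1 u p.2)
      ((Measure.pi fun _ => expMeasure 1).prod (expMeasure 1))
      (Measure.pi fun _ => expMeasure 1) := by
  have hm : Measurable fun p : (Fin n → ℝ) × ℝ => update p.1 u p.2 := by
    refine measurable_pi_iff.2 fun v => ?_
    by_cases h : v = u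
    · subst h; simpa using measurable_snd
    · simp only [update_of_ne h]; fun_prop
  refine ⟨hm, (Measure.pi_eq fun S hS => ?_).symm⟩
  rw [Measure.map_apply hm (.univ_pi hS)]
  have : (fun p : (Fin n → ℝ) × ℝ => update p.1 u p.2) ⁻¹' Set.univ.pi S =
      Set.univ.pi (update S u Set.univ) ×ˢ S u := by
    ext p
    simp only [Set.mem_preimage, Set.mem_univ_pi, Set.mem_prod]
    constructor
    · intro h
      refine ⟨fun v => ?_, by simpa using h u⟩
      by_cases hv : v = u
      · subst hv; simp
      · simpa [hv] using h v
    · rintro ⟨h2, h1⟩ v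
      by_cases hv : v = u
      · subst hv; simpa using h1
      · simpa [hv] using h2 v
  rw [this, Measure.prod_prod, Measure.pi_pi, ← Finset.mul_prod_erase _ _ (Finset.mem_univ u),
    mul_comm,
    ← Finset.mul_prod_erase _ (fun v => expMeasure 1 (S v)) (Finset.mem_univ u)]
  simp only [update_self, measure_univ, one_mul]
  congr 1
  refine Finset.prod_congr rfl fun v hv => ?_
  rw [update_of_ne (Finset.ne_of_mem_erase hv)]

theorem lintegral_pi_update (u : Fin n) {F : (Fin n → ℝ) → ENNReal} (hF : Measurable F) :
    ∫⁻ x, F x ∂Measure.pi (fun _ => expMeasure 1) =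
      ∫⁻ z, ∫⁻ x, F (Function.update x u z) ∂Measure.pi (fun _ => expMeasure 1) ∂expMeasure 1 := by
  have h := measurePreserving_update u
  rw [← h.lintegral_comp hF]
  exact lintegral_prod_symm' (fun p => F (Function.update p.1 u p.2)) (hF.comp h.measurable)

theorem ae_injective_pi :
    ∀ᵐ x ∂Measure.pi (fun _ : Fin n => expMeasure 1), Function.Injective x := by
  have h : ∀ u v : Fin n, u ≠ v → ∀ᵐ x ∂Measure.pi (fun _ : Fin n => expMeasure 1), x u ≠ x v := by
    intro u v huv
    have hS : MeasurableSet {x : Fin n → ℝ | x u = x v} :=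
      measurableSet_eq_fun (measurable_pi_apply u) (measurable_pi_apply v)
    rw [ae_iff]
    simp only [not_not]
    have hp := measurePreserving_update u
    -- After resampling coordinate `u`, a tie forces the new value into the null set `{x v}`.
    rw [← hp.measure_preimage hS.nullMeasurableSet,
      Measure.measure_prod_null (hp.measurable hS)]
    refine Filter.Eventually.of_forall fun x => ?_
    refine measure_mono_null (t := {x v}) (fun z hz => ?_) (measure_singleton _)
    simpa [Function.update_of_ne huv.symm] using hz
  have h' : ∀ᵐ x ∂Measure.pi (fun _ : Fin n => expMeasure 1), ∀ u v : Fin n, u ≠ v → x u ≠ x v := by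
    simp only [ae_all_iff]
    exact fun u v huv => h u v huv
  filter_upwards [h'] with x hx u v huv
  by_contra hne
  exact hx u v hne huv

theorem lintegral_pi_prod {w : Fin n → ℝ → ENNReal} (hw : ∀ v, Measurable (w v)) :
    ∫⁻ x, ∏ v, w v (x v) ∂Measure.pi (fun _ => expMeasure 1) = ∏ v, ∫⁻ z, w v z ∂expMeasure 1 := by
  have h := lintegral_prod_eq_prod_lintegral_of_indepFun Finset.univ
    (fun (v : Fin n) (x : Fin n → ℝ) => w v (x v))
    (iIndepFun_pi (μ := fun _ : Fin n => expMeasure 1) (X := w) fun v => (hw v).aemeasurable)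
    fun v => (hw v).comp (measurable_pi_apply v)
  rw [h]
  refine Finset.prod_congr rfl fun v _ => ?_
  exact (measurePreserving_eval (fun _ : Fin n => expMeasure 1) v).lintegral_comp (hw v)

end Law


section Law

variable {n : ℕ} {R : ℕ → ℕ} {τ : ℝ} {s : ℕ → Equiv.Perm (Fin n)} {f : ℕ → ℝ → ENNReal}

/-- The indicator of the event that `u` fails strictly before the other units of `A`. -/
noncomputable def failsFirst (A : Finset (Fin n)) (u : Fin n) (x : Fin n → ℝ) : ENNReal :=
  ∏ v ∈ A.erase u, (Set.Ioi (x u)).indicator 1 (x v)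

theorem failsFirst_eq_one {A : Finset (Fin n)} {u : Fin n} {x : Fin n → ℝ}
    (h : ∀ v ∈ A, v ≠ u → x u < x v) : failsFirst A u x = 1 := by
  refine Finset.prod_eq_one fun v hv => ?_
  rw [Finset.mem_erase] at hv
  simp [h v hv.2 hv.1]

theorem failsFirst_eq_zero {A : Finset (Fin n)} {u v : Fin n} {x : Fin n → ℝ} (hv : v ∈ A)
    (hvu : v ≠ u) (h : x v ≤ x u) : failsFirst A u x = 0 := by
  refine Finset.prod_eq_zero (Finset.mem_erase.2 ⟨hvu, hv⟩) ?_
  simp [h]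

theorem measurable_failsFirst (A : Finset (Fin n)) (u : Fin n) :
    Measurable (failsFirst A u) := by
  unfold failsFirst
  refine Finset.measurable_prod _ fun v _ => ?_
  have h : MeasurableSet {x : Fin n → ℝ | x u < x v} :=
    measurableSet_lt (measurable_pi_apply u) (measurable_pi_apply v)
  exact (measurable_one (α := ENNReal)).indicator h

theorem spacingProd_succ_of_argmin {A : Finset (Fin n)} {u : Fin n} {x : Fin n → ℝ} (hu : u ∈ A)
    (h : ∀ v ∈ A, v ≠ u → x u < x v) (k l : ℕ) (t : ℝ) :
    spacingProd R τ s f (k + 1) l A t x = f l (A.card * (x u - t)) *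
      spacingProd R τ s f k (l + 1)
        (if x u < τ then withdraw (s (l + 1)) (R (l + 1)) (A.erase u) else A.erase u) (x u) x := by
  have hff : firstFailure x A = x u := firstFailure_eq_of_le hu fun v hv => by
    by_cases hvu : v = u
    · rw [hvu]
    · exact (h v hv hvu).le
  rw [spacingProd, hff, step_of_argmin hu h]

/-- Decomposition according to the unit that fails first. -/
theorem spacingProd_succ_eq_sum {A : Finset (Fin n)} (hA : A.Nonempty) {x : Fin n → ℝ}
    (hx : Function.Injective x) (k l : ℕ) (t : ℝ) :
    spacingProd R τ s f (k + 1) l A t x = ∑ u ∈ A, failsFirst A u x *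
      (f l (A.card * (x u - t)) * spacingProd R τ s f k (l + 1)
        (if x u < τ then withdraw (s (l + 1)) (R (l + 1)) (A.erase u) else A.erase u) (x u) x) := by
  obtain ⟨u, hu, -, hmin⟩ := exists_firstFailure_eq x hA
  have hlt : ∀ v ∈ A, v ≠ u → x u < x v := fun v hv hvu =>
    lt_of_le_of_ne (hmin v hv) fun h => hvu (hx h.symm)
  rw [Finset.sum_eq_single_of_mem u hu, failsFirst_eq_one hlt, one_mul,
    spacingProd_succ_of_argmin hu hlt]
  intro v hv hvu
  rw [failsFirst_eq_zero hu hvu.symm (hmin v hv), zero_mul]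

theorem measurable_failsFirst_term (hf : ∀ j, Measurable (f j)) (k l : ℕ) (A : Finset (Fin n))
    (t : ℝ) {w : Fin n → ℝ → ENNReal} (hw : ∀ v, Measurable (w v)) (u : Fin n) :
    Measurable fun x : Fin n → ℝ => (∏ v, w v (x v)) * (failsFirst A u x *
      (f l (A.card * (x u - t)) * spacingProd R τ s f k (l + 1)
        (if x u < τ then withdraw (s (l + 1)) (R (l + 1)) (A.erase u) else A.erase u) (x u) x)) := by
  refine Measurable.mul ?_ ((measurable_failsFirst A u).mul (Measurable.mul ?_ ?_))
  · exact Finset.measurable_prod _ fun v _ => (hw v).comp (measurable_pi_apply v)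
  · exact (hf l).comp (by fun_prop)
  · have hsp (B : Finset (Fin n)) : Measurable fun x : Fin n → ℝ =>
        spacingProd R τ s f k (l + 1) B (x u) x :=
      Measurable.comp (f := fun x : Fin n → ℝ => (x u, x))
        (measurable_spacingProd (R := R) (τ := τ) (s := s) hf k (l + 1) B)
        ((measurable_pi_apply u).prodMk measurable_id)
    have hset : MeasurableSet {x : Fin n → ℝ | x u < τ} :=
      measurableSet_lt (measurable_pi_apply u) measurable_const
    have h : Measurable fun x : Fin n → ℝ => if x u < τ then spacingProd R τ s f k (l + 1)
        (withdraw (s (l + 1)) (R (l + 1)) (A.erase u)) (x u) x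
        else spacingProd R τ s f k (l + 1) (A.erase u) (x u) x :=
      Measurable.ite hset (hsp _) (hsp _)
    convert h using 2 with x
    split_ifs <;> rfl

/-- One step of the memoryless argument: fix the lifetime `z` of `u` and apply the induction
hypothesis at time `z` to the units kept on test. Each of the other `A.card - 1` units contributes
its survival probability `exp (-z)`. The result is the same for every `u` in `A`. -/
theorem lintegral_failsFirst (hf : ∀ j, Measurable (f j)) {k l : ℕ}
    (ih : ∀ (A : Finset (Fin n)) (t : ℝ), 0 ≤ t →
      k + ∑ i ∈ Finset.Icc (l + 2) (l + 1 + k), R i ≤ A.card →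
      ∀ w : Fin n → ℝ → ENNReal, (∀ v, Measurable (w v)) →
      (∀ v ∈ A, w v = (Set.Ioi t).indicator 1) →
      ∫⁻ x, (∏ v, w v (x v)) * spacingProd R τ s f k (l + 1) A t x
        ∂Measure.pi (fun _ => expMeasure 1) =
      (∏ v, ∫⁻ z, w v z ∂expMeasure 1) *
        ∏ i ∈ Finset.range k, ∫⁻ y, f (l + 1 + i) y ∂expMeasure 1)
    {A : Finset (Fin n)} {t : ℝ} (ht : 0 ≤ t)
    (hA : k + 1 + ∑ i ∈ Finset.Icc (l + 1) (l + 1 + k), R i ≤ A.card)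
    {w : Fin n → ℝ → ENNReal} (hw : ∀ v, Measurable (w v))
    (hwA : ∀ v ∈ A, w v = (Set.Ioi t).indicator 1) {u : Fin n} (hu : u ∈ A) :
    ∫⁻ x, (∏ v, w v (x v)) * (failsFirst A u x *
      (f l (A.card * (x u - t)) * spacingProd R τ s f k (l + 1)
        (if x u < τ then withdraw (s (l + 1)) (R (l + 1)) (A.erase u) else A.erase u) (x u) x))
        ∂Measure.pi (fun _ => expMeasure 1) =
      (∫⁻ z in Set.Ioi t, f l (A.card * (z - t)) * ENNReal.ofReal (Real.exp (-z)) ^ (A.card - 1)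
        ∂expMeasure 1) * ((∏ v ∈ Aᶜ, ∫⁻ z, w v z ∂expMeasure 1) *
          ∏ i ∈ Finset.range k, ∫⁻ y, f (l + 1 + i) y ∂expMeasure 1) := by
  set C : ENNReal := (∏ v ∈ Aᶜ, ∫⁻ z, w v z ∂expMeasure 1) *
          ∏ i ∈ Finset.range k, ∫⁻ y, f (l + 1 + i) y ∂expMeasure 1
  have hmeas := measurable_failsFirst_term (R := R) (τ := τ) (s := s) hf k l A t hw u
  rw [lintegral_pi_update u hmeas]
  have hpos : 1 ≤ A.card := by lia
  have hinner : ∀ z : ℝ, ∫⁻ x, (∏ v, w v (Function.update x u z v)) *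
      (failsFirst A u (Function.update x u z) *
      (f l (A.card * (Function.update x u z u - t)) * spacingProd R τ s f k (l + 1)
        (if Function.update x u z u < τ then withdraw (s (l + 1)) (R (l + 1)) (A.erase u)
          else A.erase u) (Function.update x u z u) (Function.update x u z)))
        ∂Measure.pi (fun _ => expMeasure 1) =
      (Set.Ioi t).indicator (fun z => f l (A.card * (z - t)) *
        ENNReal.ofReal (Real.exp (-z)) ^ (A.card - 1) * C) z := by
    intro z
    by_cases hz : t < z
    · set B := if z < τ then withdraw (s (l + 1)) (R (l + 1)) (A.erase u) else A.erase u with hB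
      have hBA : B ⊆ A.erase u := by
        rw [hB]; split_ifs
        · exact withdraw_subset _ _ _
        · exact subset_rfl
      -- The failure and at most `R (l + 1)` withdrawals use up the `1` and the first summand in
      -- `hA`.
      have hBcard : k + ∑ i ∈ Finset.Icc (l + 2) (l + 1 + k), R i ≤ B.card := by
        rw [← Finset.add_sum_Ioc_eq_sum_Icc (by lia)] at hA
        have : Finset.Ioc (l + 1) (l + 1 + k) = Finset.Icc (l + 2) (l + 1 + k) := by
          ext i; simp only [Finset.mem_Ioc, Finset.mem_Icc]; lia
        rw [this] at hA
        rw [hB]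
        split_ifs
        · rw [card_withdraw, Finset.card_erase_of_mem hu]; lia
        · rw [Finset.card_erase_of_mem hu]; lia
      -- Unit `u` gets weight `1`, its lifetime being fixed at `z`. The other units of `A`,
      -- including those just withdrawn, are now known to outlive `z`; units outside `A` keep their
      -- weights.
      let w' : Fin n → ℝ → ENNReal := fun v =>
        if v = u then 1 else if v ∈ A then (Set.Ioi z).indicator 1 else w v
      have hw' : ∀ v, Measurable (w' v) := by
        intro v
        simp only [w']
        split_ifs
        · exact measurable_one
        · exact measurable_one.indicator measurableSet_Ioi
        · exact hw v
      have hih := ih B z (ht.trans hz.le) hBcard w' hw' (fun v hv => by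
        have := hBA hv
        rw [Finset.mem_erase] at this
        simp [w', this.1, this.2])
      have hintegrand : ∀ x : Fin n → ℝ, (∏ v, w v (Function.update x u z v)) *
          (failsFirst A u (Function.update x u z) *
          (f l (A.card * (Function.update x u z u - t)) * spacingProd R τ s f k (l + 1)
            (if Function.update x u z u < τ then withdraw (s (l + 1)) (R (l + 1)) (A.erase u)
              else A.erase u) (Function.update x u z u) (Function.update x u z))) =
          f l (A.card * (z - t)) * ((∏ v, w' v (x v)) * spacingProd R τ s f k (l + 1) B z x) := by
        intro x
        have hsp : spacingProd R τ s f k (l + 1) B z (Function.update x u z) =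
            spacingProd R τ s f k (l + 1) B z x :=
          spacingProd_congr k (l + 1) z fun v hv =>
            Function.update_of_ne (Finset.ne_of_mem_erase (hBA hv)) _ _
        have hprod : (∏ v, w v (Function.update x u z v)) *
            failsFirst A u (Function.update x u z) = ∏ v, w' v (x v) := by
          have hff : failsFirst A u (Function.update x u z) =
              ∏ v, if v ∈ A.erase u then (Set.Ioi z).indicator 1 (x v) else 1 := by
            rw [failsFirst, Finset.prod_ite_mem, Finset.univ_inter]
            refine Finset.prod_congr rfl fun v hv => ?_
            rw [Function.update_self, Function.update_of_ne (Finset.ne_of_mem_erase hv)]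
          rw [hff, ← Finset.prod_mul_distrib]
          refine Finset.prod_congr rfl fun v _ => ?_
          by_cases hvu : v = u
          · subst hvu
            simp [w', hwA v hu, hz]
          · by_cases hvA : v ∈ A
            · by_cases hxv : z < x v
              · simp [w', hvu, hvA, hwA v hvA, hxv, hz.trans hxv]
              · simp [w', hvu, hvA, hxv]
            · simp [w', hvu, hvA]
        rw [← hprod, Function.update_self, ← hB, hsp]
        ring
      simp_rw [hintegrand]
      rw [lintegral_const_mul _ ?_, hih, Set.indicator_of_mem (by exact hz), mul_assoc]
      · congr 1
        rw [← mul_assoc]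
        congr 1
        rw [← Finset.prod_mul_prod_compl A, ← Finset.mul_prod_erase _ _ hu]
        have h1 : ∫⁻ y, w' u y ∂expMeasure 1 = 1 := by simp [w']
        have h2 : ∏ v ∈ A.erase u, ∫⁻ y, w' v y ∂expMeasure 1 =
            ENNReal.ofReal (Real.exp (-z)) ^ (A.card - 1) := by
          rw [← Finset.card_erase_of_mem hu, ← Finset.prod_const]
          refine Finset.prod_congr rfl fun v hv => ?_
          rw [Finset.mem_erase] at hv
          simp only [w', hv.1, hv.2, if_true, if_false]
          rw [lintegral_indicator_one measurableSet_Ioi, expMeasure_one_Ioi (ht.trans hz.le)]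
        rw [h1, h2, one_mul]
        congr 1
        refine Finset.prod_congr rfl fun v hv => ?_
        rw [Finset.mem_compl] at hv
        simp [w', hv, show v ≠ u from fun h => hv (h ▸ hu)]
      · refine Measurable.mul ?_ ?_
        · exact Finset.measurable_prod _ fun v _ => (hw' v).comp (measurable_pi_apply v)
        · exact (measurable_spacingProd hf k (l + 1) B).comp
            (measurable_const.prodMk measurable_id)
    -- For `z ≤ t` the weight of `u` vanishes, as it was on test at time `t`.
    · rw [Set.indicator_of_notMem (by exact hz)]
      have : ∀ x : Fin n → ℝ, ∏ v, w v (Function.update x u z v) = 0 := fun x =>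
        Finset.prod_eq_zero (Finset.mem_univ u) (by simp [hwA u hu, hz])
      simp [this]
  simp_rw [hinner]
  rw [lintegral_indicator measurableSet_Ioi, lintegral_mul_const]
  exact ((hf l).comp (by fun_prop)).mul (by fun_prop)

/-- Given that the units in `A` are on test at time `t`, the next normalized spacings are
independent and standard exponential. -/
theorem lintegral_prod_mul_spacingProd (hf : ∀ j, Measurable (f j)) (k l : ℕ)
    (A : Finset (Fin n)) (t : ℝ) (ht : 0 ≤ t)
    (hA : k + ∑ i ∈ Finset.Icc (l + 1) (l + k), R i ≤ A.card)
    (w : Fin n → ℝ → ENNReal) (hw : ∀ v, Measurable (w v))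
    (hwA : ∀ v ∈ A, w v = (Set.Ioi t).indicator 1) :
    ∫⁻ x, (∏ v, w v (x v)) * spacingProd R τ s f k l A t x ∂Measure.pi (fun _ => expMeasure 1) =
      (∏ v, ∫⁻ z, w v z ∂expMeasure 1) *
        ∏ i ∈ Finset.range k, ∫⁻ y, f (l + i) y ∂expMeasure 1 := by
  induction k generalizing l A t w with
  | zero => simp [spacingProd, lintegral_pi_prod hw]
  | succ k ih =>
    have hpos : 1 ≤ A.card := by lia
    rw [show l + (k + 1) = l + 1 + k by ring] at hA
    have hae : ∀ᵐ x ∂Measure.pi (fun _ : Fin n => expMeasure 1),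
        (∏ v, w v (x v)) * spacingProd R τ s f (k + 1) l A t x =
        ∑ u ∈ A, (∏ v, w v (x v)) * (failsFirst A u x *
      (f l (A.card * (x u - t)) * spacingProd R τ s f k (l + 1)
        (if x u < τ then withdraw (s (l + 1)) (R (l + 1)) (A.erase u) else A.erase u) (x u) x)) := by
      filter_upwards [ae_injective_pi] with x hx
      rw [spacingProd_succ_eq_sum (Finset.card_pos.1 hpos) hx, Finset.mul_sum]
    rw [lintegral_congr_ae hae, lintegral_finsetSum']
    -- All units of `A` contribute equally, so the sum produces the factor `A.card` needed for
    -- `lintegral_exp_spacing`.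
    · rw [Finset.sum_congr rfl fun u hu =>
        lintegral_failsFirst hf (fun A t ht hA w => ih (l + 1) A t ht hA w) ht hA hw hwA hu,
        Finset.sum_const, nsmul_eq_mul, ← mul_assoc, lintegral_exp_spacing hpos ht,
        ← Finset.prod_mul_prod_compl A (fun v => ∫⁻ z, w v z ∂expMeasure 1)]
      have h2 : ∏ v ∈ A, ∫⁻ y, w v y ∂expMeasure 1 = ENNReal.ofReal (Real.exp (-t)) ^ A.card := by
        rw [← Finset.prod_const]
        refine Finset.prod_congr rfl fun v hv => ?_
        rw [hwA v hv, lintegral_indicator_one measurableSet_Ioi, expMeasure_one_Ioi ht]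
      rw [h2, Finset.prod_range_succ']
      simp only [add_zero, add_assoc, add_comm 1]
      ring
    · exact fun u _ => (measurable_failsFirst_term hf k l A t hw u).aemeasurable

theorem ae_expMeasure_one_pos : ∀ᵐ z ∂expMeasure 1, 0 < z := by
  have h : expMeasure 1 (Set.Ioi 0)ᶜ = 0 := by
    rw [prob_compl_eq_zero_iff measurableSet_Ioi, expMeasure_one_Ioi le_rfl]
    simp
  exact measure_mono_null (fun z hz => by simpa using hz) h

theorem lintegral_prod_spacing (hf : ∀ j, Measurable (f j)) {m : ℕ}
    (hm : m + ∑ j ∈ Finset.Icc 1 m, R j = n) :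
    ∫⁻ x, ∏ i ∈ Finset.range m, f i (spacing R τ s x i)
        ∂Measure.pi (fun _ : Fin n => expMeasure 1) =
      ∏ i ∈ Finset.range m, ∫⁻ y, f i y ∂expMeasure 1 := by
  have h := lintegral_prod_mul_spacingProd (R := R) (τ := τ) (s := s) hf m 0 Finset.univ 0 le_rfl
    (by simpa using hm.le) (fun _ => (Set.Ioi 0).indicator 1)
    (fun _ => measurable_one.indicator measurableSet_Ioi) (fun _ _ => rfl)
  simp only [lintegral_indicator_one measurableSet_Ioi, expMeasure_one_Ioi le_rfl, neg_zero,
    Real.exp_zero, ENNReal.ofReal_one, Finset.prod_const_one, one_mul, zero_add] at h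
  rw [← h]
  refine lintegral_congr_ae ?_
  -- At time `0` with all units on test the weights are almost surely `1` and disappear.
  have hpos : ∀ᵐ x ∂Measure.pi (fun _ : Fin n => expMeasure 1), ∀ v, x v ∈ Set.Ioi (0 : ℝ) := by
    rw [ae_all_iff]
    intro v
    exact (Measure.quasiMeasurePreserving_eval (fun _ : Fin n => expMeasure 1) v).ae
      ae_expMeasure_one_pos
  filter_upwards [hpos] with x hx
  have := prod_spacing_eq_spacingProd (R := R) (τ := τ) (s := s) (f := f) x m 0
  simp only [zero_add, if_true] at this
  rw [this]
  simp [Set.indicator_of_mem (hx _), survivors]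

theorem measurable_spacing_vector (R : ℕ → ℕ) (τ : ℝ) (s : ℕ → Equiv.Perm (Fin n)) (m : ℕ) :
    Measurable fun x (i : Fin m) => spacing R τ s x i :=
  measurable_pi_lambda _ fun i => measurable_spacing R τ (s := fun _ => s)
    (fun _ => measurable_const) measurable_id i

/-- The normalized spacings are independent and standard exponential, for any priority orders. -/
theorem map_spacing_pi {m : ℕ} (hm : m + ∑ j ∈ Finset.Icc 1 m, R j = n) :
    (Measure.pi fun _ : Fin n => expMeasure 1).map (fun x (i : Fin m) => spacing R τ s x i) =
      Measure.pi fun _ => expMeasure 1 := by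
  have hmeas := measurable_spacing_vector R τ s m
  refine (Measure.pi_eq fun S hS => ?_).symm
  have h := lintegral_prod_spacing (R := R) (τ := τ) (s := s) (m := m)
    (f := fun j => if hj : j < m then (S ⟨j, hj⟩).indicator 1 else 0)
    (fun j => by
      by_cases hj : j < m
      · simp only [hj, dif_pos]; exact measurable_one.indicator (hS _)
      · simp only [hj, dif_neg, not_false_eq_true]; exact measurable_zero) hm
  rw [Finset.prod_range] at h
  simp only [Fin.is_lt, dif_pos, Fin.eta, lintegral_indicator_one (hS _)] at h
  rw [← h, Measure.map_apply hmeas (.univ_pi hS),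
    ← lintegral_indicator_one (hmeas (.univ_pi hS))]
  refine lintegral_congr fun x => ?_
  rw [Finset.prod_range]
  have hmem : x ∈ (fun x (i : Fin m) => spacing R τ s x i) ⁻¹' (Set.univ.pi S) ↔
      ∀ i : Fin m, spacing R τ s x i ∈ S i := by
    simp
  classical
  refine ((Set.indicator_apply _ _ _).trans (if_congr hmem rfl rfl)).trans ?_
  simp only [Fin.is_lt, dif_pos, Fin.eta, Set.indicator, Pi.one_apply]
  by_cases h1 : ∀ i : Fin m, spacing R τ s x i ∈ S i
  · simp [h1]
  · rw [if_neg h1]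
    push Not at h1
    obtain ⟨i, hi⟩ := h1
    rw [Finset.prod_eq_zero (Finset.mem_univ i) (by rw [if_neg hi])]

end Law


/-! ### Reduction to exponential lifetimes by the hazard transform -/

/-- The cumulative hazard function of `IEP(α, β)`. -/
noncomputable def hazard (α β t : ℝ) : ℝ := -Real.log (1 - iepCDF α β t)

theorem U_eq_hazard (α β : ℝ) (T : ℕ → ℝ) (j : ℕ) : U α β T j = hazard α β (T j) := rfl

section Hazard

variable {α β : ℝ}

theorem hazard_of_nonpos {t : ℝ} (ht : t ≤ 0) : hazard α β t = 0 := by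
  simp [hazard, iepCDF, ht.not_gt]

theorem hazard_of_pos (hβ : 0 < β) {t : ℝ} (ht : 0 < t) :
    hazard α β t = -α * Real.log (1 - (t / (1 + t)) ^ β) := by
  rw [hazard, iepCDF_of_pos ht, Real.log_rpow (one_sub_rpow_pos hβ ht)]
  ring

theorem measurable_hazard (α β : ℝ) : Measurable (hazard α β) := by
  unfold hazard iepCDF
  refine (Real.measurable_log.comp (measurable_const.sub ?_)).neg
  exact Measurable.ite measurableSet_Ioi (by fun_prop) measurable_const

theorem strictMonoOn_hazard (hα : 0 < α) (hβ : 0 < β) :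
    StrictMonoOn (hazard α β) (Set.Ioi 0) := by
  intro x hx y hy hxy
  have hx : 0 < x := hx
  have hy : 0 < y := hy
  rw [hazard_of_pos hβ hx, hazard_of_pos hβ hy, neg_mul, neg_mul, neg_lt_neg_iff]
  refine mul_lt_mul_of_pos_left (Real.log_lt_log (one_sub_rpow_pos hβ hy) ?_) hα
  have h : (x / (1 + x)) ^ β < (y / (1 + y)) ^ β := by
    refine Real.rpow_lt_rpow (by positivity) ?_ hβ
    rw [div_lt_div_iff₀ (by positivity) (by positivity)]
    nlinarith
  linarith

theorem hazard_pos (hα : 0 < α) (hβ : 0 < β) {t : ℝ} (ht : 0 < t) : 0 < hazard α β t := by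
  rw [hazard_of_pos hβ ht]
  have h : 0 < (t / (1 + t)) ^ β := by positivity
  have := Real.log_neg (one_sub_rpow_pos hβ ht) (by linarith)
  nlinarith

theorem hazard_nonneg (hα : 0 < α) (hβ : 0 < β) (t : ℝ) : 0 ≤ hazard α β t := by
  rcases le_or_gt t 0 with h | h
  · rw [hazard_of_nonpos h]
  · exact (hazard_pos hα hβ h).le

/-- No sign is imposed on `y`, so that a threshold `τ ≤ 0` is covered: there the hazard is `0`,
below that of any positive lifetime. -/
theorem lt_iff_hazard_lt (hα : 0 < α) (hβ : 0 < β) {x : ℝ} (hx : 0 < x) (y : ℝ) :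
    x < y ↔ hazard α β x < hazard α β y := by
  rcases le_or_gt y 0 with h | h
  · rw [hazard_of_nonpos h]
    exact iff_of_false (by linarith) (hazard_pos hα hβ hx).le.not_gt
  · exact ((strictMonoOn_hazard hα hβ).lt_iff_lt hx h).symm

theorem exists_hazard_le_iff (hα : 0 < α) (hβ : 0 < β) {y : ℝ} (hy : 0 ≤ y) :
    ∃ t, (∀ x, hazard α β x ≤ y ↔ x ≤ t) ∧ iepCDF α β t = 1 - Real.exp (-y) := by
  set p : ℝ := 1 - Real.exp (-(y / α)) with hp
  have hp0 : 0 ≤ p := by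
    have : Real.exp (-(y / α)) ≤ 1 := Real.exp_le_one_iff.2 (neg_nonpos.2 (by positivity))
    linarith
  have hp1 : p < 1 := by
    have := Real.exp_pos (-(y / α))
    linarith
  set q : ℝ := p ^ β⁻¹ with hq
  have hq0 : 0 ≤ q := by positivity
  have hq1 : q < 1 := Real.rpow_lt_one hp0 hp1 (by positivity)
  have hqp : q ^ β = p := Real.rpow_inv_rpow hp0 hβ.ne'
  -- The quantile: `q` solves `1 - q ^ β = exp (-(y / α))`, and `q / (1 - q)` inverts `t / (1 + t) =
  -- q`.
  refine ⟨q / (1 - q), fun x => ?_, ?_⟩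
  · rcases le_or_gt x 0 with hx | hx
    · rw [hazard_of_nonpos hx]
      exact iff_of_true hy (hx.trans (div_nonneg hq0 (by linarith)))
    · rw [hazard_of_pos hβ hx, le_div_iff₀ (by linarith)]
      have h1 : -α * Real.log (1 - (x / (1 + x)) ^ β) ≤ y ↔
          -(y / α) ≤ Real.log (1 - (x / (1 + x)) ^ β) := by
        rw [neg_mul, neg_le, ← neg_div, div_le_iff₀' hα]
      rw [h1, Real.le_log_iff_exp_le (one_sub_rpow_pos hβ hx)]
      have h2 : Real.exp (-(y / α)) ≤ 1 - (x / (1 + x)) ^ β ↔ (x / (1 + x)) ^ β ≤ q ^ β := by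
        rw [hqp, hp]
        constructor <;> intro h <;> linarith
      rw [h2, Real.rpow_le_rpow_iff (by positivity) hq0 hβ, div_le_iff₀ (by positivity)]
      constructor <;> intro h <;> linarith
  -- For `y = 0` the quantile is `0`, which falls in the zero branch of `iepCDF`.
  · rcases hy.eq_or_lt with rfl | hy
    · have hp' : p = 0 := by simp [hp]
      have hq' : q = 0 := by rw [hq, hp', Real.zero_rpow (by positivity)]
      simp [hq', iepCDF]
    · have hp' : 0 < p := by
        have : Real.exp (-(y / α)) < 1 := Real.exp_lt_one_iff.2 (neg_neg_of_pos (by positivity))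
        linarith
      have hq' : 0 < q := by positivity
      have ht : 0 < q / (1 - q) := div_pos hq' (by linarith)
      have hne : 1 - q ≠ 0 := by linarith
      have h3 : q / (1 - q) / (1 + q / (1 - q)) = q := by
        field_simp
        ring
      rw [iepCDF, if_pos ht, h3, hqp, hp, sub_sub_cancel, ← Real.exp_mul]
      congr 2
      field_simp

theorem hasLaw_hazard {Ω : Type*} [MeasurableSpace Ω] {μ : Measure Ω} [IsProbabilityMeasure μ]
    (hα : 0 < α) (hβ : 0 < β) {X : Ω → ℝ} (hX : Measurable X)
    (hlaw : ∀ t, cdf (μ.map X) t = iepCDF α β t) :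
    HasLaw (fun ω => hazard α β (X ω)) (expMeasure 1) μ := by
  have hm : Measurable fun ω => hazard α β (X ω) := (measurable_hazard α β).comp hX
  refine ⟨hm.aemeasurable, ?_⟩
  have : IsProbabilityMeasure (μ.map X) := Measure.isProbabilityMeasure_map hX.aemeasurable
  have : IsProbabilityMeasure (μ.map fun ω => hazard α β (X ω)) :=
    Measure.isProbabilityMeasure_map hm.aemeasurable
  refine Measure.eq_of_cdf _ _ ?_
  ext y
  rw [cdf_expMeasure_eq one_pos, cdf_eq_real, map_measureReal_apply hm measurableSet_Iic]
  split_ifs with hy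
  · obtain ⟨t, h1, h2⟩ := exists_hazard_le_iff hα hβ hy
    rw [one_mul, ← h2, ← hlaw, cdf_eq_real, map_measureReal_apply hX measurableSet_Iic]
    congr 1
    ext ω
    simp [h1]
  · have : (fun ω => hazard α β (X ω)) ⁻¹' Set.Iic y = ∅ := by
      ext ω
      have := hazard_nonneg hα hβ (X ω)
      simp
      linarith
    rw [this]
    simp

theorem ae_pos_of_cdf {Ω : Type*} [MeasurableSpace Ω] {μ : Measure Ω} [IsProbabilityMeasure μ]
    {X : Ω → ℝ} (hX : Measurable X) (hlaw : ∀ t, cdf (μ.map X) t = iepCDF α β t) :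
    ∀ᵐ ω ∂μ, 0 < X ω := by
  have : IsProbabilityMeasure (μ.map X) := Measure.isProbabilityMeasure_map hX.aemeasurable
  have h := hlaw 0
  rw [cdf_eq_real, map_measureReal_apply hX measurableSet_Iic, iepCDF, if_neg (lt_irrefl _),
    measureReal_eq_zero_iff] at h
  exact measure_mono_null (fun ω hω => by simpa using hω) h

end Hazard

/-! ### Failure times and spacings under the hazard transform -/

section Experiment

variable (c : Plan) {α β : ℝ} {s : ℕ → Equiv.Perm (Fin c.n)} {x : Fin c.n → ℝ} {T : ℕ → ℝ}

theorem failureTime_eq (j : ℕ) :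
    failureTime c s x j = firstFailure x (survivors c.R c.τ s x (j - 1)) := by
  rw [failureTime, onTest_eq_survivors]

theorem Γ_eq_card (hx : Function.Injective x) (hT : ∀ j, T j = failureTime c s x j) {j : ℕ}
    (h1 : 1 ≤ j) (h2 : j ≤ c.m) : Γ c T j = ((onTest c s x (j - 1)).card : ℤ) := by
  have hTm : ∀ j, 1 ≤ j → j + 1 ≤ c.m → T j < T (j + 1) := by
    intro j h1 h2
    rw [hT, hT, failureTime_eq, failureTime_eq, Nat.add_sub_cancel]
    have := firstFailure_survivors_lt (τ := c.τ) (s := s) hx c.sum_R (j := j - 1) (by lia)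
    rwa [Nat.sub_add_cancel h1] at this
  have h := card_survivors_add (τ := c.τ) (s := s) hx c.sum_R (j := j - 1) (by lia)
  have hsum : ∑ l ∈ Finset.Icc 1 (j - 1),
      (if firstFailure x (survivors c.R c.τ s x (l - 1)) < c.τ then c.R l else 0) =
      ∑ l ∈ Finset.Icc 1 (min (J c T) (j - 1)), c.R l := by
    rw [← Finset.sum_filter]
    refine Finset.sum_congr ?_ fun _ _ => rfl
    ext l
    simp only [Finset.mem_filter, Finset.mem_Icc, le_min_iff]
    constructor
    · rintro ⟨⟨ha, hb⟩, h3⟩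
      rw [← failureTime_eq, ← hT, ← le_J_iff c hTm ha (by lia)] at h3
      exact ⟨ha, h3, hb⟩
    · rintro ⟨ha, h3, hb⟩
      rw [le_J_iff c hTm ha (by lia), hT, failureTime_eq] at h3
      exact ⟨⟨ha, hb⟩, h3⟩
  rw [hsum] at h
  rw [Γ, onTest_eq_survivors]
  have h' : (c.n : ℤ) = (survivors c.R c.τ s x (j - 1)).card + (j - 1 : ℕ) +
      ∑ l ∈ Finset.Icc 1 (min (J c T) (j - 1)), (c.R l : ℤ) := by
    exact_mod_cast h.symm
  have hj : ((j - 1 : ℕ) : ℤ) = j - 1 := by rw [Nat.cast_sub h1, Nat.cast_one]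
  linarith

theorem failureTime_pos (hx : Function.Injective x) (hpos : ∀ u, 0 < x u) {j : ℕ}
    (h1 : 1 ≤ j) (h2 : j ≤ c.m) : 0 < failureTime c s x j := by
  rw [failureTime_eq]
  obtain ⟨u, -, h, -⟩ := exists_firstFailure_eq x
    (survivors_nonempty (τ := c.τ) (s := s) hx c.sum_R (j := j - 1) (by lia))
  rw [h]
  exact hpos u

theorem survivors_hazard (hα : 0 < α) (hβ : 0 < β) (hpos : ∀ u, 0 < x u) (j : ℕ) :
    survivors c.R c.τ s x j =
      survivors c.R (hazard α β c.τ) s (fun u => hazard α β (x u)) j :=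
  survivors_congr_order (fun u _ => lt_iff_hazard_lt hα hβ (hpos u) _)
    (fun u => lt_iff_hazard_lt hα hβ (hpos u) _) j

theorem hazard_failureTime (hα : 0 < α) (hβ : 0 < β) (hx : Function.Injective x)
    (hpos : ∀ u, 0 < x u) {j : ℕ} (h1 : 1 ≤ j) (h2 : j ≤ c.m) :
    hazard α β (failureTime c s x j) = firstFailure (fun u => hazard α β (x u))
      (survivors c.R (hazard α β c.τ) s (fun u => hazard α β (x u)) (j - 1)) := by
  rw [failureTime_eq, ← survivors_hazard c hα hβ hpos]
  obtain ⟨u, hu, h, hmin⟩ := exists_firstFailure_eq x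
    (survivors_nonempty (τ := c.τ) (s := s) hx c.sum_R (j := j - 1) (by lia))
  rw [h, firstFailure_eq_of_le hu fun _ hv =>
    not_lt.1 fun hlt => (hmin _ hv).not_gt ((lt_iff_hazard_lt hα hβ (hpos _) _).2 hlt)]

/-- The normalized spacings are those of an experiment with exponential lifetimes. -/
theorem V_eq_spacing (hα : 0 < α) (hβ : 0 < β) (hx : Function.Injective x)
    (hpos : ∀ u, 0 < x u) (hT : ∀ j, T j = failureTime c s x j) {j : ℕ} (h1 : 1 ≤ j)
    (h2 : j ≤ c.m) :
    V c α β T j = spacing c.R (hazard α β c.τ) s (fun u => hazard α β (x u)) (j - 1) := by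
  rw [V, spacing, Γ_eq_card c hx hT h1 h2, onTest_eq_survivors, survivors_hazard c hα hβ hpos,
    U_eq_hazard, hT j, hazard_failureTime c hα hβ hx hpos h1 h2]
  by_cases hj : j = 1
  · simp [hj]
  · rw [if_neg hj, if_neg (by lia), U_eq_hazard, hT,
      hazard_failureTime c hα hβ hx hpos (by lia) (by lia)]
    simp

end Experiment


/-! ### Several facilities and random priority orders -/

section Facilities

variable {k : ℕ} {n m : Fin k → ℕ}

/-- Blocks of independent variables, as independent vectors. -/
theorem hasLaw_pi_pi {Ω : Type*} [MeasurableSpace Ω] {μ : Measure Ω} [IsProbabilityMeasure μ]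
    {E : (i : Fin k) → Fin (n i) → Ω → ℝ} {P : Measure ℝ} [IsProbabilityMeasure P]
    (hlaw : ∀ i u, HasLaw (E i u) P μ)
    (hind : iIndepFun (fun p : (i : Fin k) × Fin (n i) => E p.1 p.2) μ) :
    HasLaw (fun ω i u => E i u ω) (Measure.pi fun i => Measure.pi fun _ : Fin (n i) => P) μ := by
  have h := hind.hasLaw_pi (fun p : (i : Fin k) × Fin (n i) => hlaw p.1 p.2)
  have h2 := Measure.infinitePi_map_piCurry (X := fun (i : Fin k) (_ : Fin (n i)) => ℝ)
    (fun _ _ => P)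
  simp only [Measure.infinitePi_eq_pi] at h2
  have h3 : MeasurePreserving (MeasurableEquiv.piCurry fun (i : Fin k) (_ : Fin (n i)) => ℝ)
      (Measure.pi fun _ => P) (Measure.pi fun i => Measure.pi fun _ : Fin (n i) => P) :=
    ⟨MeasurableEquiv.measurable _, h2⟩
  exact h3.fun_comp_hasLaw h

variable {R : Fin k → ℕ → ℕ} {τ : Fin k → ℝ}

theorem map_spacing_pi_pi (hm : ∀ i, m i + ∑ j ∈ Finset.Icc 1 (m i), R i j = n i)
    (σ : (i : Fin k) → ℕ → Equiv.Perm (Fin (n i))) :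
    (Measure.pi fun i => Measure.pi fun _ : Fin (n i) => expMeasure 1).map
      (fun x i (j : Fin (m i)) => spacing (R i) (τ i) (σ i) (x i) j) =
      Measure.pi fun _ => Measure.pi fun _ => expMeasure 1 :=
  (measurePreserving_pi _ _ fun i =>
    ⟨measurable_spacing_vector (R i) (τ i) (σ i) (m i), map_spacing_pi (hm i)⟩).map_eq

/-- The normalized spacings of independent experiments with exponential lifetimes are independent
and standard exponential, also if the withdrawals are random but independent of the lifetimes. -/
theorem hasLaw_spacing {Ω : Type*} [MeasurableSpace Ω] {μ : Measure Ω} [IsProbabilityMeasure μ]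
    (hm : ∀ i, m i + ∑ j ∈ Finset.Icc 1 (m i), R i j = n i)
    {E : Ω → (i : Fin k) → Fin (n i) → ℝ}
    (hE : HasLaw E (Measure.pi fun _ => Measure.pi fun _ => expMeasure 1) μ)
    {s : Ω → (q : (_ : Fin k) × ℕ) → Equiv.Perm (Fin (n q.1))} (hs : Measurable s)
    (hind : IndepFun E s μ) :
    HasLaw (fun ω i (j : Fin (m i)) => spacing (R i) (τ i) (fun l => s ω ⟨i, l⟩) (E ω i) j)
      (Measure.pi fun _ => Measure.pi fun _ => expMeasure 1) μ := by
  let Z : ((i : Fin k) → Fin (n i) → ℝ) × ((q : (_ : Fin k) × ℕ) → Equiv.Perm (Fin (n q.1))) →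
      (i : Fin k) → Fin (m i) → ℝ :=
    fun p i j => spacing (R i) (τ i) (fun l => p.2 ⟨i, l⟩) (p.1 i) j
  have hZ : Measurable Z := measurable_pi_lambda _ fun i => measurable_pi_lambda _ fun j =>
    measurable_spacing (R i) (τ i)
      (fun l => (measurable_pi_apply (⟨i, l⟩ : (_ : Fin k) × ℕ)).comp measurable_snd)
      ((measurable_pi_apply i).comp measurable_fst) j
  have hp : HasLaw (fun ω => (E ω, s ω))
      ((Measure.pi fun i => Measure.pi fun _ => expMeasure 1).prod (μ.map s)) μ :=
    (indepFun_iff_hasLaw_prodMk_prod hE ⟨hs.aemeasurable, rfl⟩).1 hind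
  have : IsProbabilityMeasure (μ.map s) := Measure.isProbabilityMeasure_map hs.aemeasurable
  refine MeasurePreserving.fun_comp_hasLaw (Y := Z) ⟨hZ, ?_⟩ hp
  ext B hB
  rw [Measure.map_apply hZ hB, Measure.prod_apply_symm (hZ hB)]
  -- For each fixed choice of priority orders the law is the same product measure, so averaging over
  -- the orders returns that measure.
  have hslice : ∀ σ, (Measure.pi fun i => Measure.pi fun _ : Fin (n i) => expMeasure 1)
      ((fun e => (e, σ)) ⁻¹' (Z ⁻¹' B)) =
      (Measure.pi fun i => Measure.pi fun _ : Fin (m i) => expMeasure 1) B := by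
    intro σ
    have hm' : Measurable fun e => Z (e, σ) := hZ.comp (measurable_id.prodMk measurable_const)
    rw [← map_spacing_pi_pi (τ := τ) hm fun i l => σ ⟨i, l⟩]
    exact (Measure.map_apply hm' hB).symm
  simp [hslice]

end Facilities

/-! ### Pivots and ratios through the logarithmic ratios -/

section Pivots

variable {Ω : Type*} [MeasurableSpace Ω] {μ : Measure Ω} {c : Plan} {α β : ℝ} {T : ℕ → ℝ}

theorem pivot_eq_logRatio (hα : 0 < α)
    (hU : ∀ j, 1 ≤ j → j ≤ c.m → U α β T j = -α * φ β T j) {y : ℕ → ℝ}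
    (hy : ∀ j, 1 ≤ j → j ≤ c.m → V c α β T j = y j) (hpos : ∀ j, 1 ≤ j → j ≤ c.m → 0 < y j) :
    pivot c β T = 2 * ∑ j ∈ Finset.Icc 1 (c.m - 1), logRatio y j := by
  have hm : c.m - 1 + 1 = c.m := Nat.sub_add_cancel c.one_le_m
  have h := sum_log_ratio_eq (v := y) (m := c.m - 1) (by rwa [hm])
  rw [hm] at h
  rw [pivot_eq_sum_log_Q c hα hU, ← neg_eq_iff_eq_neg.2 h, neg_mul, mul_neg, neg_inj]
  congr 1
  refine Finset.sum_congr rfl fun j hj => ?_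
  rw [Finset.mem_Icc] at hj
  have hW : ∀ j ≤ c.m, W c α β T j = partialSum y j := fun j hj => partialSum_congr hy hj
  rw [Q, hW j (by lia), hW _ le_rfl]

theorem Q_eq_exp {y : ℕ → ℝ} (hy : ∀ j, 1 ≤ j → j ≤ c.m → V c α β T j = y j)
    (hpos : ∀ j, 1 ≤ j → j ≤ c.m → 0 < y j) {j : ℕ} (h1 : 1 ≤ j) (h2 : j ≤ c.m) :
    Q c α β T j = Real.exp (-∑ l ∈ Finset.Ico j c.m, logRatio y l / l) := by
  have hm : c.m - 1 + 1 = c.m := Nat.sub_add_cancel c.one_le_m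
  have h := ratio_eq_exp_sum (v := y) (m := c.m - 1) (by rwa [hm]) h1 (by rwa [hm])
  rw [hm] at h
  have hW : ∀ j ≤ c.m, W c α β T j = partialSum y j := fun j hj => partialSum_congr hy hj
  rw [Q, hW j h2, hW _ le_rfl, h]

end Pivots

end BlockCensoring

/-! ### Assembly of the main theorem -/

open BlockCensoring
theorem mainTheorem3 {Ω : Type*} [MeasurableSpace Ω] (μ : Measure Ω) [IsProbabilityMeasure μ]
    -- `k` facilities with their censoring plans, and the parameters of the lifetimes
    (k : ℕ) (c : Fin k → Plan) (α : Fin k → ℝ) (β : ℝ) (hα : ∀ i, 0 < α i) (hβ : 0 < β)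
    -- `X i u` is the lifetime of unit `u` of facility `i`: independent, `IEP(α i, β)` distributed
    (X : (i : Fin k) → Fin (c i).n → Ω → ℝ)
    (hX_meas : ∀ i u, Measurable (X i u))
    (hX_law : ∀ i u t, cdf (μ.map (X i u)) t = iepCDF (α i) β t)
    (hX_indep : iIndepFun (fun (p : (i : Fin k) × Fin (c i).n) => X p.1 p.2) μ)
    -- `s i j` is the random priority order that selects the units withdrawn at the `j`-th failure
    -- in facility `i`; the selection is independent of the lifetimes
    (s : (i : Fin k) → ℕ → Ω → Equiv.Perm (Fin (c i).n))
    (hs_meas : ∀ i j, Measurable (s i j))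
    (hs_indep : IndepFun (fun ω (p : (i : Fin k) × Fin (c i).n) => X p.1 p.2 ω)
      (fun ω (q : (_ : Fin k) × ℕ) => s q.1 q.2 ω) μ)
    -- `T i ω j` is the `j`-th observed failure time in facility `i`
    (T : Fin k → Ω → ℕ → ℝ)
    (hT : ∀ i ω j, T i ω j = failureTime (c i) (fun l => s i l ω) (fun u => X i u ω) j) :
    -- `Γ i j` is the number of units on test just before the `j`-th failure
    (∀ᵐ ω ∂μ, ∀ i, ∀ j ∈ Finset.Icc 1 (c i).m, Γ (c i) (T i ω) j =
      ((onTest (c i) (fun l => s i l ω) (fun u => X i u ω) (j - 1)).card : ℤ)) ∧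
    -- the explicit forms of `U`, `W` and of the pivotal quantities
    (∀ᵐ ω ∂μ, ∀ i, ∀ j ∈ Finset.Icc 1 (c i).m,
      U (α i) β (T i ω) j = -α i * φ β (T i ω) j ∧
      W (c i) (α i) β (T i ω) j = -α i * S (c i) β (T i ω) j) ∧
    (∀ᵐ ω ∂μ, ∀ i, pivot (c i) β (T i ω) =
      -2 * ∑ j ∈ Finset.Icc 1 ((c i).m - 1), Real.log (Q (c i) (α i) β (T i ω) j)) ∧
    -- the normalized spacings are i.i.d. standard exponential
    ((∀ i, ∀ j ∈ Finset.Icc 1 (c i).m,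
        HasLaw (fun ω => V (c i) (α i) β (T i ω) j) (expMeasure 1) μ) ∧
      iIndepFun (fun (p : (i : Fin k) × Fin (c i).m) ω =>
        V (c p.1) (α p.1) β (T p.1 ω) (p.2 + 1)) μ) ∧
    -- the pivotal quantities
    (∀ i, HasLaw (fun ω => pivot (c i) β (T i ω)) (chiSquared (2 * ((c i).m - 1))) μ) ∧
    iIndepFun (fun i ω => pivot (c i) β (T i ω)) μ ∧
    HasLaw (fun ω => ∑ i, pivot (c i) β (T i ω)) (chiSquared (2 * ∑ i, ((c i).m - 1))) μ ∧
    -- `2 W m`, and its independence of the ratios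
    (∀ i, HasLaw (fun ω => 2 * W (c i) (α i) β (T i ω) (c i).m) (chiSquared (2 * (c i).m)) μ) ∧
    (∀ i, IndepFun (fun ω => 2 * W (c i) (α i) β (T i ω) (c i).m)
      (fun ω (j : Fin ((c i).m - 1)) => Q (c i) (α i) β (T i ω) (j + 1)) μ) := by
  have hm1 (i : Fin k) : (c i).m - 1 + 1 = (c i).m := Nat.sub_add_cancel (c i).one_le_m
  have hhaz (i : Fin k) := measurable_hazard (α i) β
  -- the exponential lifetimes
  let E : (i : Fin k) → Fin (c i).n → Ω → ℝ := fun i u ω => hazard (α i) β (X i u ω)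
  have hE_ind : iIndepFun (fun p : (i : Fin k) × Fin (c i).n => E p.1 p.2) μ :=
    hX_indep.comp (fun p => hazard (α p.1) β) fun p => hhaz p.1
  have hE_law := hasLaw_pi_pi
    (fun i u => hasLaw_hazard (hα i) hβ (hX_meas i u) (hX_law i u)) hE_ind
  have hs_meas' : Measurable fun ω (q : (_ : Fin k) × ℕ) => s q.1 q.2 ω :=
    measurable_pi_lambda _ fun q => hs_meas q.1 q.2
  have hEs : IndepFun (fun ω i u => E i u ω) (fun ω (q : (_ : Fin k) × ℕ) => s q.1 q.2 ω) μ :=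
    hs_indep.comp (φ := fun (x : (i : Fin k) × Fin (c i).n → ℝ) i u => hazard (α i) β (x ⟨i, u⟩))
      (ψ := id) (measurable_pi_lambda _ fun i => measurable_pi_lambda _ fun u =>
        (hhaz i).comp (measurable_pi_apply _)) measurable_id
  -- measurable versions of the normalized spacings
  let Y : Fin k → ℕ → Ω → ℝ := fun i l ω =>
    spacing (c i).R (hazard (α i) β (c i).τ) (fun l => s i l ω) (fun u => E i u ω) (l - 1)
  have hY_meas (i : Fin k) (l : ℕ) : Measurable (Y i l) :=
    measurable_spacing _ _ (hs_meas i)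
      (measurable_pi_lambda _ fun u => (hhaz i).comp (hX_meas i u)) _
  have hY := hasLaw_spacing (m := fun i => (c i).m) (R := fun i => (c i).R)
    (τ := fun i => hazard (α i) β (c i).τ) (fun i => (c i).sum_R) hE_law hs_meas' hEs
  have hY_row (i : Fin k) : HasLaw (fun ω (j : Fin (c i).m) => Y i (j + 1) ω)
      (Measure.pi fun _ => expMeasure 1) μ :=
    (measurePreserving_eval (fun i => Measure.pi fun _ : Fin (c i).m => expMeasure 1) i
      ).fun_comp_hasLaw hY
  have hY_rows : iIndepFun (fun i ω (j : Fin (c i).m) => Y i (j + 1) ω) μ :=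
    (iIndepFun_iff_hasLaw_pi_pi hY_row).2 hY
  have hY_law (i : Fin k) (j : ℕ) (h1 : 1 ≤ j) (h2 : j ≤ (c i).m) :
      HasLaw (Y i j) (expMeasure 1) μ := by
    have h := (measurePreserving_eval (fun _ : Fin (c i).m => expMeasure 1)
      ⟨j - 1, by lia⟩).fun_comp_hasLaw (hY_row i)
    simpa [Nat.sub_add_cancel h1] using h
  have hY_ind (i : Fin k) : iIndepFun (fun j : Fin (c i).m => Y i (j + 1)) μ :=
    (iIndepFun_iff_hasLaw_pi_pi fun j : Fin (c i).m => hY_law i (j + 1) (by lia) (by lia)).2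
      (hY_row i)
  have hY_ind' (i : Fin k) : iIndepFun (fun j : Fin ((c i).m - 1 + 1) => Y i (j + 1)) μ := by
    -- The index types `Fin (m - 1 + 1)` and `Fin m` are not definitionally equal; generalizing the
    -- bound allows substitution.
    have : ∀ M, M = (c i).m → iIndepFun (fun j : Fin M => Y i (j + 1)) μ := by
      rintro _ rfl
      exact hY_ind i
    exact this _ (hm1 i)
  have hY_law' (i : Fin k) (j : ℕ) (h1 : 1 ≤ j) (h2 : j ≤ (c i).m - 1 + 1) :
      HasLaw (Y i j) (expMeasure 1) μ := hY_law i j h1 (by rwa [hm1] at h2)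
  have hY_aem (i : Fin k) (l : ℕ) : AEMeasurable (Y i l) μ := (hY_meas i l).aemeasurable
  -- almost sure properties
  have hX_pos : ∀ᵐ ω ∂μ, ∀ i u, 0 < X i u ω := by
    simp only [ae_all_iff]
    exact fun i u => ae_pos_of_cdf (hX_meas i u) (hX_law i u)
  have hX_inj : ∀ᵐ ω ∂μ, ∀ i, Function.Injective fun u => X i u ω := by
    rw [ae_all_iff]
    intro i
    have h := (measurePreserving_eval (fun i => Measure.pi fun _ : Fin (c i).n => expMeasure 1) i
      ).fun_comp_hasLaw hE_law
    have h2 : ∀ᵐ x ∂μ.map (fun ω u => E i u ω), Function.Injective x := by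
      rw [h.map_eq]
      exact ae_injective_pi
    filter_upwards [ae_of_ae_map h.aemeasurable h2] with ω hω u v huv
    -- Tied lifetimes would have tied hazards, which almost surely do not occur.
    exact hω (congrArg (hazard (α i) β) huv)
  have hY_pos : ∀ᵐ ω ∂μ, ∀ i j, 1 ≤ j → j ≤ (c i).m → 0 < Y i j ω := by
    simp only [ae_all_iff]
    intro i j h1 h2
    have h := hY_law i j h1 h2
    refine ae_of_ae_map h.aemeasurable (p := fun y => 0 < y) ?_
    rw [h.map_eq]
    exact ae_expMeasure_one_pos
  have hΓ : ∀ᵐ ω ∂μ, ∀ i, ∀ j ∈ Finset.Icc 1 (c i).m, Γ (c i) (T i ω) j =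
      ((onTest (c i) (fun l => s i l ω) (fun u => X i u ω) (j - 1)).card : ℤ) := by
    filter_upwards [hX_inj] with ω hinj i j hj
    rw [Finset.mem_Icc] at hj
    exact Γ_eq_card (c i) (hinj i) (hT i ω) hj.1 hj.2
  have hU : ∀ᵐ ω ∂μ, ∀ i j, 1 ≤ j → j ≤ (c i).m →
      U (α i) β (T i ω) j = -α i * φ β (T i ω) j := by
    filter_upwards [hX_pos, hX_inj] with ω hpos hinj i j h1 h2
    refine U_eq_neg_mul_φ hβ ?_
    rw [hT]
    exact failureTime_pos (c i) (hinj i) (hpos i) h1 h2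
  have hV : ∀ᵐ ω ∂μ, ∀ i j, 1 ≤ j → j ≤ (c i).m → V (c i) (α i) β (T i ω) j = Y i j ω := by
    filter_upwards [hX_pos, hX_inj] with ω hpos hinj i j h1 h2
    exact V_eq_spacing (c i) (hα i) hβ (hinj i) (hpos i) (hT i ω) h1 h2
  have hpiv : ∀ᵐ ω ∂μ, ∀ i, pivot (c i) β (T i ω) =
      2 * ∑ j ∈ Finset.Icc 1 ((c i).m - 1), logRatio (fun l => Y i l ω) j := by
    filter_upwards [hU, hV, hY_pos] with ω hU hV hpos i
    exact pivot_eq_logRatio (hα i) (hU i) (hV i) (hpos i)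
  have hQ : ∀ᵐ ω ∂μ, ∀ i j, 1 ≤ j → j ≤ (c i).m → Q (c i) (α i) β (T i ω) j =
      Real.exp (-∑ l ∈ Finset.Ico j (c i).m, logRatio (fun l => Y i l ω) l / l) := by
    filter_upwards [hV, hY_pos] with ω hV hpos i j h1 h2
    exact Q_eq_exp (hV i) (hpos i) h1 h2
  have hW : ∀ᵐ ω ∂μ, ∀ i, 2 * W (c i) (α i) β (T i ω) (c i).m =
      2 * partialSum (fun l => Y i l ω) ((c i).m - 1 + 1) := by
    filter_upwards [hV] with ω hV i
    rw [hm1]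
    exact congrArg (2 * ·) (partialSum_congr (hV i) le_rfl)
  have two_mul_law {D : Ω → ℝ} {d : ℕ} (hD : HasLaw D (erlang d) μ) :
      HasLaw (fun ω => 2 * D ω) (chiSquared (2 * d)) μ :=
    MeasurePreserving.fun_comp_hasLaw ⟨by fun_prop, map_two_mul_erlang d⟩ hD
  have hsum_law (i : Fin k) := hasLaw_sum_logRatio (hY_aem i) ((c i).m - 1) (hY_law' i) (hY_ind' i)
  have hsum_ind : iIndepFun (fun i ω => ∑ j ∈ Finset.Icc 1 ((c i).m - 1),
      logRatio (fun l => Y i l ω) j) μ := by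
    have h := hY_rows.comp (fun i y => ∑ j ∈ Finset.Icc 1 ((c i).m - 1),
      logRatio (extendSeq (c i).m y) j) fun i => by fun_prop
    convert h using 3 with i ω
    refine Finset.sum_congr rfl fun j hj => ?_
    rw [Finset.mem_Icc] at hj
    exact (logRatio_congr (extendSeq_eq (c i).m fun l => Y i l ω) (by have := hm1 i; lia)).symm
  refine ⟨hΓ, ?_, ?_, ⟨?_, ?_⟩, ?_, ?_, ?_, ?_, ?_⟩
  · filter_upwards [hU] with ω hU i j hj
    rw [Finset.mem_Icc] at hj
    exact ⟨hU i j hj.1 hj.2, W_eq_neg_mul_S (c i) (hU i) hj.1 hj.2⟩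
  · filter_upwards [hU] with ω hU i
    exact pivot_eq_sum_log_Q (c i) (hα i) (hU i)
  · intro i j hj
    rw [Finset.mem_Icc] at hj
    exact (hY_law i j hj.1 hj.2).congr (by filter_upwards [hV] with ω hV using hV i j hj.1 hj.2)
  · have h := iIndepFun_uncurry (X := fun i (j : Fin (c i).m) => Y i (j + 1))
      (fun i j => hY_meas i (j + 1)) hY_rows hY_ind
    refine (iIndepFun_congr fun p => ?_).1 h
    filter_upwards [hV] with ω hV
    exact (hV p.1 (p.2 + 1) (by lia) (by lia)).symm
  · intro i
    refine (two_mul_law (hsum_law i)).congr ?_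
    filter_upwards [hpiv] with ω h using h i
  · have h := hsum_ind.comp (fun _ x => 2 * x) fun _ => by fun_prop
    refine (iIndepFun_congr fun i => ?_).1 h
    filter_upwards [hpiv] with ω h using (h i).symm
  · refine (two_mul_law (hasLaw_sum_erlang hsum_law hsum_ind Finset.univ)).congr ?_
    filter_upwards [hpiv] with ω h
    rw [Finset.mul_sum]
    exact Finset.sum_congr rfl fun i _ => h i
  · intro i
    have h := two_mul_law (hasLaw_partialSum (hY_aem i) ((c i).m - 1) (hY_law' i) (hY_ind' i))
    rw [hm1] at h
    refine h.congr ?_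
    filter_upwards [hW] with ω h
    rw [h i, hm1]
  · intro i
    -- The map `ψ` rebuilds all the `Q` from the finite vector of logarithmic ratios. Only indices
    -- `l ≤ m - 1` enter, so the zero padding of `extendSeq` is never read.
    have h := (indepFun_logRatio_partialSum (hY_aem i) ((c i).m - 1) (hY_law' i)
      (hY_ind' i)).symm.comp (φ := fun w => 2 * w)
      (ψ := fun (y : Fin ((c i).m - 1) → ℝ) (j : Fin ((c i).m - 1)) =>
        Real.exp (-∑ l ∈ Finset.Ico ((j : ℕ) + 1) (c i).m, extendSeq ((c i).m - 1) y l / l))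
      (by fun_prop) (by fun_prop)
    refine h.congr ?_ ?_
    · filter_upwards [hW] with ω h using (h i).symm
    · filter_upwards [hQ] with ω h
      ext j
      have hj := hm1 i
      rw [h i (j + 1) (by lia) (by lia)]
      simp only [Function.comp]
      congr 2
      refine Finset.sum_congr rfl fun l hl => ?_
      rw [Finset.mem_Ico] at hl
      rw [extendSeq_eq ((c i).m - 1) (fun l => logRatio (fun l => Y i l ω) l) l (by lia) (by lia)]
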